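/- Let $\mathbb{N}^*=\{1,2,3,\dots\}$ and, for $s\ge 0$, let $h^{s}(\mathbb{C})$ be the set of complex sequences $(a_k)_{k\in\mathbb{N}^*}$ with $\sum_{k\in\mathbb{N}^*}|k^{s}a_k|^2<\infty$. Let $(\omega_k)_{k\in\mathbb{N}^*}\subset[0,\infty)$ be a nondecreasing sequence with $\omega_1=0$ for which there exist $\tilde d\ge 0$, $\delta>0$, $C>0$ and $\mathcal{M}\in\mathbb{N}^*$ such that $$\inf_{k\in\mathbb{N}^*}|\omega_{k+\mathcal{M}}-\omega_k|\ \ge\ \delta\mathcal{M},\qquad |\omega_{k+1}-\omega_k|\ \ge\ C\,k^{-\frac{\tilde d}{\mathcal{M}-1}}\quad\text{for all }k\in\mathbb{N}^*,$$ where the second condition is omitted if $\mathcal{M}=1$. Then for every $T>2\pi/\delta$ and every $(x_k)_{k\in\mathbb{N}^*}\in h^{\tilde d}(\mathbb{C})$ with $x_1\in\mathbb{R}$ there exists a real-valued $u\in L^2((0,T),\mathbb{R})$ such that $$x_k=\int_0^T u(\tau)\,e^{i\omega_k\tau}\,d\tau\qquad\text{for all }k\in\mathbb{N}^*.$$ 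-/

import Mathlib

/-- The weighted sequence space `h^s(ℂ)`: the complex sequences `(a_k)_{k ≥ 1}` such that
`∑_k |k^s a_k|^2 < ∞`. -/
def hSpace (s : ℝ) : Set (ℕ+ → ℂ) :=
  {a | Summable fun k : ℕ+ => ‖(((((k : ℕ) : ℝ) ^ s : ℝ)) : ℂ) * a k‖ ^ 2}

open Filter Topology MeasureTheory FourierTransform

/-! Put `p k = ω k / (2π)` and `g = δM / (2π)`. By Paley–Wiener, it suffices to find, for each `k`,
an entire function `G k` of exponential type at most `πT` that is 1 at `p k`, vanishes at the other
nodes and decays quadratically away from `p k`. The data are then matched by superposing the inverse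
images of `c k * G k`, supported in `[-T/2, T/2]`.

The nodes split into `M` residue classes modulo `M`, each `g`-separated. A separated set lies in the
zero set of a function of type `π/g` with polynomial growth
(`exists_entire_vanishing_on_separated`), proved by comparison with the sine product. The product
over the classes has type `Mπ/g = 2π²/δ < πT`, and the slack pays for a multiplier that turns growth
into decay (`exists_interpolating_family`). Normalising at `p k` costs one inverse distance from `p
k` to each of the other `M - 1` classes, at most a constant times `k ^ (d/(M-1))` apiece. The total
loss `k ^ d` is the weight of `h^d`. Plancherel and Cauchy–Schwarz sum the series in `L²`
(`exists_memLp_hasSum_integral_exp`).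

For a real solution, the moments at the reflected nodes `-p k`, `k > 1`, are prescribed to be zero.
Then `2 Re V` has the right moments; the frequency 0 is its own reflection, whence the condition on
`x 1`. -/

/-! ### Canonical products with real zeros, compared with the sine product. -/

/-- The sequence `q` falls and then rises. Each `t m` is matched with `q m` on the falling part and
with `q (m + 1)` afterwards, which leaves one factor `q j` over. Keeping `q j` on the left avoids
dividing by it. -/
lemma exists_prod_mul_le_prod_succ {q t : ℕ → ℝ} (hq : ∀ m, 0 ≤ q m) (ht0 : ∀ m, 0 ≤ t m)
    (ht : ∀ m, t m ≤ max (q m) (q (m + 1)))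
    (hmono : ∀ m n, n ≤ m → q (m + 1) < q m → q (n + 1) ≤ q n) (R : ℕ) :
    ∃ j, (∏ m ∈ Finset.range R, t m) * q j ≤ ∏ m ∈ Finset.range (R + 1), q m := by
  induction R with
  | zero => exact ⟨0, by simp⟩
  | succ R ih =>
    obtain ⟨j, hj⟩ := ih
    by_cases h : t R ≤ q (R + 1)
    · refine ⟨j, ?_⟩
      rw [Finset.prod_range_succ t R, Finset.prod_range_succ q (R + 1), mul_right_comm]
      exact mul_le_mul hj h (ht0 R) (Finset.prod_nonneg fun m _ => hq m)
    · refine ⟨R + 1, ?_⟩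
      rw [Finset.prod_range_succ q (R + 1)]
      refine mul_le_mul_of_nonneg_right (Finset.prod_le_prod (fun m _ => ht0 m) ?_) (hq _)
      intro m hm
      have h1 : q (R + 1) < q R := by
        rcases le_max_iff.1 (ht R) with h2 | h2 <;> [exact (not_le.1 h).trans_le h2; exact absurd h2 h]
      have h3 := hmono R m (Nat.lt_succ_iff.1 (Finset.mem_range.1 hm)) h1
      exact (ht m).trans (max_le le_rfl h3)

lemma sq_norm_one_sub_ofReal_mul (z : ℂ) (s : ℝ) :
    ‖1 - (s : ℂ) * z‖ ^ 2 = 1 - 2 * s * z.re + s ^ 2 * (z.re ^ 2 + z.im ^ 2) := by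
  rw [Complex.sq_norm, Complex.normSq_apply]
  simp
  ring

/-- The squared norm is a convex quadratic in `s`, so its maximum over an interval is at an
endpoint. -/
lemma norm_one_sub_ofReal_mul_le_max (z : ℂ) {s₁ s s₂ : ℝ} (h₁ : s₁ ≤ s) (h₂ : s ≤ s₂) :
    ‖1 - (s : ℂ) * z‖ ≤ max ‖1 - (s₂ : ℂ) * z‖ ‖1 - (s₁ : ℂ) * z‖ := by
  have e := sq_norm_one_sub_ofReal_mul z
  rw [le_max_iff]
  by_contra! hcon
  obtain ⟨c2, c1⟩ := hcon
  have d2 := pow_lt_pow_left₀ c2 (norm_nonneg _) two_ne_zero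
  have d1 := pow_lt_pow_left₀ c1 (norm_nonneg _) two_ne_zero
  rw [e, e] at d1 d2
  have p : 0 ≤ z.re ^ 2 + z.im ^ 2 := by positivity
  set P := z.re ^ 2 + z.im ^ 2
  have f2 : 0 < (s₂ - s) * (2 * z.re - P * (s + s₂)) := by nlinarith
  have f1 : 0 < (s - s₁) * (P * (s + s₁) - 2 * z.re) := by nlinarith
  have g2 := (pos_iff_pos_of_mul_pos f2).1 (lt_of_le_of_ne (by linarith) (fun h => by
    rw [← h] at f2; simp at f2))
  have g1 := (pos_iff_pos_of_mul_pos f1).1 (lt_of_le_of_ne (by linarith) (fun h => by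
    rw [← h] at f1; simp at f1))
  nlinarith [mul_nonneg p (by linarith : 0 ≤ s₂ - s₁)]

/-- By the same convexity, an increase persists to the right. With `s = 1/(m+1)` this gives the
fall-then-rise shape needed in `exists_prod_mul_le_prod_succ`. -/
lemma norm_one_sub_ofReal_mul_mono (z : ℂ) {s₁ s₂ s₃ s₄ : ℝ} (h12 : s₁ < s₂) (h23 : s₂ ≤ s₃)
    (h34 : s₃ ≤ s₄) (h : ‖1 - (s₁ : ℂ) * z‖ < ‖1 - (s₂ : ℂ) * z‖) :
    ‖1 - (s₃ : ℂ) * z‖ ≤ ‖1 - (s₄ : ℂ) * z‖ := by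
  have e := sq_norm_one_sub_ofReal_mul z
  have d := pow_lt_pow_left₀ h (norm_nonneg _) two_ne_zero
  refine (sq_le_sq₀ (norm_nonneg _) (norm_nonneg _)).1 ?_
  rw [e, e] at d ⊢
  have p : 0 ≤ z.re ^ 2 + z.im ^ 2 := by positivity
  set P := z.re ^ 2 + z.im ^ 2
  have f2 : 0 < (s₂ - s₁) * (P * (s₁ + s₂) - 2 * z.re) := by nlinarith
  have g2 := (pos_iff_pos_of_mul_pos f2).1 (by linarith)
  have : 0 ≤ (s₄ - s₃) * (P * (s₃ + s₄) - 2 * z.re) := by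
    refine mul_nonneg (by linarith) ?_
    nlinarith [mul_nonneg p (by linarith : 0 ≤ s₃ + s₄ - s₁ - s₂)]
  nlinarith

/-- A lower bound for the leftover factor: off the strip `|Im z| < 1` it is at least `1/(1 + ‖z‖)`.
-/
lemma one_le_norm_one_sub_mul {z : ℂ} (hz : 1 ≤ |z.im|) (j : ℕ) :
    1 ≤ ‖1 - (((j : ℝ) + 1)⁻¹ : ℝ) * z‖ * (1 + ‖z‖) := by
  have hj : (0 : ℝ) < (j : ℝ) + 1 := by positivity
  have e : 1 - (((j : ℝ) + 1)⁻¹ : ℝ) * z = (((j : ℝ) + 1)⁻¹ : ℝ) * ((((j : ℝ) + 1 : ℝ) : ℂ) - z) := by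
    rw [mul_sub, ← Complex.ofReal_mul, inv_mul_cancel₀ hj.ne']
    simp
  rw [e, norm_mul, Complex.norm_real, Real.norm_of_nonneg (inv_nonneg.2 hj.le), mul_assoc,
    ← div_eq_inv_mul, le_div_iff₀ hj, one_mul]
  have h1 : 1 ≤ ‖(((j : ℝ) + 1 : ℝ) : ℂ) - z‖ := by
    refine le_trans ?_ (Complex.abs_im_le_norm _)
    simpa using hz
  have h2 : (j : ℝ) + 1 ≤ ‖(((j : ℝ) + 1 : ℝ) : ℂ) - z‖ + ‖z‖ := by
    calc (j : ℝ) + 1 = ‖(((j : ℝ) + 1 : ℝ) : ℂ)‖ := by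
          rw [Complex.norm_real, Real.norm_of_nonneg hj.le]
      _ = ‖((((j : ℝ) + 1 : ℝ) : ℂ) - z) + z‖ := by simp
      _ ≤ _ := norm_add_le _ _
  nlinarith [norm_nonneg z]

/-- Moving each zero `m + 1` of the product outwards, by at most one, costs a factor `1 + ‖z‖`. -/
lemma prod_norm_one_sub_le {z : ℂ} (hz : 1 ≤ |z.im|) {a : ℕ → ℝ}
    (ha : ∀ m : ℕ, (m : ℝ) + 1 ≤ a m ∧ a m ≤ (m : ℝ) + 2) (R : ℕ) :
    ∏ m ∈ Finset.range R, ‖1 - ((a m)⁻¹ : ℝ) * z‖ ≤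
      (1 + ‖z‖) * ∏ m ∈ Finset.range (R + 1), ‖1 - (((m : ℝ) + 1)⁻¹ : ℝ) * z‖ := by
  obtain ⟨j, hj⟩ := exists_prod_mul_le_prod_succ
    (q := fun m : ℕ => ‖1 - (((m : ℝ) + 1)⁻¹ : ℝ) * z‖) (t := fun m => ‖1 - ((a m)⁻¹ : ℝ) * z‖)
    (fun _ => norm_nonneg _) (fun _ => norm_nonneg _)
    (fun m => by
      have hm : (0 : ℝ) < (m : ℝ) + 1 := by positivity
      refine norm_one_sub_ofReal_mul_le_max z ?_ ?_
      · refine inv_anti₀ (hm.trans_le (ha m).1) ?_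
        push_cast
        linarith [(ha m).2]
      · exact inv_anti₀ hm (ha m).1)
    (fun m n hnm h => by
      have hm : (0 : ℝ) < (m : ℝ) + 1 := by positivity
      have hn : (0 : ℝ) < (n : ℝ) + 1 := by positivity
      have hc : (n : ℝ) ≤ m := by exact_mod_cast hnm
      rcases hnm.lt_or_eq with hlt | rfl
      · refine norm_one_sub_ofReal_mul_mono z ?_ ?_ ?_ h
        · exact inv_strictAnti₀ hm (by push_cast; linarith)
        · refine inv_anti₀ (by positivity) ?_
          have : (n : ℝ) + 1 ≤ m := by exact_mod_cast hlt
          push_cast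
          linarith
        · exact inv_anti₀ hn (by push_cast; linarith)
      · exact h.le) R
  set X := ∏ m ∈ Finset.range R, ‖1 - ((a m)⁻¹ : ℝ) * z‖
  have hX : 0 ≤ X := Finset.prod_nonneg fun _ _ => norm_nonneg _
  calc X ≤ X * (‖1 - (((j : ℝ) + 1)⁻¹ : ℝ) * z‖ * (1 + ‖z‖)) :=
        le_mul_of_one_le_right hX (one_le_norm_one_sub_mul hz j)
    _ = (1 + ‖z‖) * (X * ‖1 - (((j : ℝ) + 1)⁻¹ : ℝ) * z‖) := by ring
    _ ≤ _ := mul_le_mul_of_nonneg_left hj (by positivity)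

lemma norm_sin_le_exp (z : ℂ) : ‖Complex.sin z‖ ≤ Real.exp |z.im| := by
  have h1 : ‖Complex.exp (-z * Complex.I)‖ ≤ Real.exp |z.im| := by
    rw [Complex.norm_exp]
    exact Real.exp_le_exp.2 (by simpa using le_abs_self z.im)
  have h2 : ‖Complex.exp (z * Complex.I)‖ ≤ Real.exp |z.im| := by
    rw [Complex.norm_exp]
    exact Real.exp_le_exp.2 (by simpa using neg_le_abs z.im)
  rw [Complex.sin, norm_div, norm_mul, Complex.norm_I, mul_one, Complex.norm_ofNat]
  linarith [norm_sub_le (Complex.exp (-z * Complex.I)) (Complex.exp (z * Complex.I))]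

/-- The elementary factor `(1 - z / a) (1 + z / b)`. -/
noncomputable def pairFactor (a b : ℝ) (z : ℂ) : ℂ :=
  (1 - ((a⁻¹ : ℝ) : ℂ) * z) * (1 - ((b⁻¹ : ℝ) : ℂ) * -z)

lemma norm_one_sub_le_of_re_eq {s : ℝ} {z w : ℂ} (hre : z.re = w.re) (him : |z.im| ≤ |w.im|) :
    ‖1 - (s : ℂ) * z‖ ≤ ‖1 - (s : ℂ) * w‖ := by
  refine (sq_le_sq₀ (norm_nonneg _) (norm_nonneg _)).1 ?_
  rw [sq_norm_one_sub_ofReal_mul, sq_norm_one_sub_ofReal_mul, hre]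
  have := sq_le_sq.2 him
  nlinarith [mul_nonneg (sq_nonneg s) (sub_nonneg.2 this)]

lemma prod_norm_pairFactor_le_euler {z : ℂ} (hz : 1 ≤ |z.im|) {a b : ℕ → ℝ}
    (ha : ∀ m : ℕ, (m : ℝ) + 1 ≤ a m ∧ a m ≤ (m : ℝ) + 2)
    (hb : ∀ m : ℕ, (m : ℝ) + 1 ≤ b m ∧ b m ≤ (m : ℝ) + 2) (R : ℕ) :
    ∏ m ∈ Finset.range R, ‖pairFactor (a m) (b m) z‖ ≤
      (1 + ‖z‖) ^ 2 * ‖∏ m ∈ Finset.range (R + 1), (1 - z ^ 2 / ((m : ℂ) + 1) ^ 2)‖ := by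
  have h1 := prod_norm_one_sub_le hz ha R
  have h2 := prod_norm_one_sub_le (z := -z) (by simpa using hz) hb R
  simp only [pairFactor, norm_mul, Finset.prod_mul_distrib]
  refine (mul_le_mul h1 h2 (Finset.prod_nonneg fun _ _ => norm_nonneg _) (by positivity)).trans_eq ?_
  rw [norm_neg, mul_mul_mul_comm, ← sq, ← Finset.prod_mul_distrib, norm_prod]
  congr 1
  refine Finset.prod_congr rfl fun m _ => ?_
  rw [← norm_mul]
  congr 1
  have : (m : ℂ) + 1 ≠ 0 := by exact_mod_cast m.succ_ne_zero
  push_cast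
  field_simp
  ring

/-- Moving `z` vertically away from the real axis only enlarges every factor. Hence `z` may be
replaced by a point with `|Im| ≥ 1`, where the comparison with Euler's product applies, at the cost
of a factor `e^π`. -/
lemma norm_lim_pairFactor_le {a b : ℕ → ℝ}
    (ha : ∀ m : ℕ, (m : ℝ) + 1 ≤ a m ∧ a m ≤ (m : ℝ) + 2)
    (hb : ∀ m : ℕ, (m : ℝ) + 1 ≤ b m ∧ b m ≤ (m : ℝ) + 2) {z w : ℂ}
    (hw : Tendsto (fun R => ∏ m ∈ Finset.range R, pairFactor (a m) (b m) z) atTop (𝓝 w)) :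
    ‖w‖ ≤ (2 + ‖z‖) ^ 2 * Real.exp (Real.pi * (|z.im| + 1)) := by
  set z' : ℂ := ⟨z.re, |z.im| + 1⟩ with hz'
  have him : |z'.im| = |z.im| + 1 := abs_of_nonneg (by positivity)
  have hge : 1 ≤ |z'.im| := by rw [him]; linarith [abs_nonneg z.im]
  have hnorm : ‖z'‖ ≤ 1 + ‖z‖ := by
    refine (sq_le_sq₀ (norm_nonneg _) (by positivity)).1 ?_
    have h1 := Complex.abs_im_le_norm z
    have h2 : ‖z‖ ^ 2 = z.re ^ 2 + |z.im| ^ 2 := by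
      rw [Complex.sq_norm, Complex.normSq_apply, sq_abs]; ring
    have h3 : ‖z'‖ ^ 2 = z.re ^ 2 + (|z.im| + 1) ^ 2 := by
      rw [Complex.sq_norm, Complex.normSq_apply]; simp only [hz']; ring
    rw [h3]
    nlinarith
  have hz'1 : 1 ≤ ‖z'‖ := hge.trans (Complex.abs_im_le_norm _)
  have hz'0 : z' ≠ 0 := norm_pos_iff.1 (by linarith)
  have hsin := (((Complex.tendsto_euler_sin_prod z').comp (tendsto_add_atTop_nat 1)).norm).const_mul
    ((2 + ‖z‖) ^ 2)
  refine (le_of_tendsto_of_tendsto' hw.norm hsin fun R => ?_).trans ?_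
  · rw [norm_prod]
    calc ∏ m ∈ Finset.range R, ‖pairFactor (a m) (b m) z‖
        ≤ ∏ m ∈ Finset.range R, ‖pairFactor (a m) (b m) z'‖ := by
          refine Finset.prod_le_prod (fun _ _ => norm_nonneg _) fun m _ => ?_
          rw [pairFactor, pairFactor, norm_mul, norm_mul]
          have hi : |z.im| ≤ |z'.im| := by rw [him]; linarith
          exact mul_le_mul (norm_one_sub_le_of_re_eq rfl hi)
            (norm_one_sub_le_of_re_eq (by simp [hz']) (by simpa using hi)) (norm_nonneg _)
            (norm_nonneg _)
      _ ≤ (1 + ‖z'‖) ^ 2 * ‖∏ m ∈ Finset.range (R + 1), (1 - z' ^ 2 / ((m : ℂ) + 1) ^ 2)‖ :=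
          prod_norm_pairFactor_le_euler hge ha hb R
      _ ≤ (2 + ‖z‖) ^ 2 * (‖(Real.pi : ℂ) * z'‖ *
            ‖∏ m ∈ Finset.range (R + 1), (1 - z' ^ 2 / ((m : ℂ) + 1) ^ 2)‖) := by
          refine mul_le_mul (pow_le_pow_left₀ (by positivity) (by linarith) 2)
            (le_mul_of_one_le_left (norm_nonneg _) ?_) (norm_nonneg _) (by positivity)
          rw [norm_mul, Complex.norm_real, Real.norm_of_nonneg Real.pi_pos.le]
          nlinarith [Real.pi_gt_three]
      _ = _ := by simp [Function.comp]
  · refine mul_le_mul_of_nonneg_left ((norm_sin_le_exp _).trans_eq ?_) (by positivity)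
    rw [Complex.im_ofReal_mul, abs_mul, him, abs_of_pos Real.pi_pos]

/-- Pairing nearly cancels the linear terms: `|1/b - 1/a| ≤ 1/(ab)` since `|a - b| ≤ 1`, so the
product converges. -/
lemma norm_pairFactor_sub_one_le {a b : ℝ} {m : ℕ} (ha : (m : ℝ) + 1 ≤ a ∧ a ≤ (m : ℝ) + 2)
    (hb : (m : ℝ) + 1 ≤ b ∧ b ≤ (m : ℝ) + 2) {z : ℂ} {r : ℝ} (hz : ‖z‖ ≤ r) :
    ‖pairFactor a b z - 1‖ ≤ (r + r ^ 2) * (1 / ((m : ℝ) + 1) ^ 2) := by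
  have hm : (0 : ℝ) < (m : ℝ) + 1 := by positivity
  have ha0 := hm.trans_le ha.1
  have hb0 := hm.trans_le hb.1
  have hr : 0 ≤ r := (norm_nonneg z).trans hz
  have e : pairFactor a b z - 1 = ((b⁻¹ - a⁻¹ : ℝ) : ℂ) * z + ((-(a⁻¹ * b⁻¹) : ℝ) : ℂ) * z ^ 2 := by
    rw [pairFactor]; push_cast; ring
  have hab : (m + 1 : ℝ) ^ 2 ≤ a * b := by nlinarith [ha.1, hb.1]
  have hinv : (a * b)⁻¹ ≤ 1 / ((m : ℝ) + 1) ^ 2 := by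
    rw [one_div]; exact inv_anti₀ (by positivity) hab
  have h1 : |b⁻¹ - a⁻¹| ≤ (a * b)⁻¹ := by
    rw [inv_sub_inv hb0.ne' ha0.ne', abs_div, abs_of_pos (mul_pos hb0 ha0), mul_comm b a,
      div_eq_mul_inv]
    refine mul_le_of_le_one_left (by positivity) (abs_le.2 ⟨by linarith [ha.1, hb.2], by linarith [ha.2, hb.1]⟩)
  rw [e]
  refine (norm_add_le _ _).trans ?_
  rw [norm_mul, norm_mul, Complex.norm_real, Complex.norm_real, norm_pow, Real.norm_eq_abs,
    Real.norm_eq_abs, abs_neg, abs_of_pos (by positivity : 0 < a⁻¹ * b⁻¹), ← mul_inv, add_mul]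
  have hz2 : ‖z‖ ^ 2 ≤ r ^ 2 := pow_le_pow_left₀ (norm_nonneg _) hz 2
  refine add_le_add ?_ ?_
  · rw [mul_comm r]
    exact mul_le_mul (h1.trans hinv) hz (norm_nonneg _) (by positivity)
  · rw [mul_comm (r ^ 2)]
    exact mul_le_mul hinv hz2 (by positivity) (by positivity)

lemma differentiable_pairFactor (a b : ℝ) : Differentiable ℂ (pairFactor a b) := by
  unfold pairFactor
  fun_prop

/-- Canonical products over real zeros lying in the consecutive intervals `±[m + 1, m + 2]`. -/
lemma exists_tendsto_prod_pairFactor {a b : ℕ → ℝ}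
    (ha : ∀ m : ℕ, (m : ℝ) + 1 ≤ a m ∧ a m ≤ (m : ℝ) + 2)
    (hb : ∀ m : ℕ, (m : ℝ) + 1 ≤ b m ∧ b m ≤ (m : ℝ) + 2) :
    ∃ H : ℂ → ℂ, Differentiable ℂ H ∧
      ∀ z, Tendsto (fun R => ∏ m ∈ Finset.range R, pairFactor (a m) (b m) z) atTop (𝓝 (H z)) := by
  have hsum : ∀ r : ℝ, Summable fun m : ℕ => (r + r ^ 2) * (1 / ((m : ℝ) + 1) ^ 2) := fun r => by
    refine Summable.mul_left _ ?_
    have := (summable_nat_add_iff 1).2 (Real.summable_one_div_nat_pow.2 (by norm_num : 1 < 2))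
    simpa using this
  have hloc : ∀ r : ℝ, HasProdLocallyUniformlyOn
      (fun (m : ℕ) (z : ℂ) => 1 + (pairFactor (a m) (b m) z - 1))
      (fun z => ∏' m : ℕ, (1 + (pairFactor (a m) (b m) z - 1))) (Metric.ball 0 r) := fun r => by
    refine (hsum r).hasProdLocallyUniformlyOn_nat_one_add Metric.isOpen_ball ?_ ?_
    · filter_upwards with m z hz
      exact norm_pairFactor_sub_one_le (ha m) (hb m) (by simpa using (mem_ball_zero_iff.1 hz).le)
    · intro m
      have := (differentiable_pairFactor (a m) (b m)).continuous
      fun_prop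
  simp only [add_sub_cancel] at hloc
  refine ⟨fun z => ∏' m : ℕ, pairFactor (a m) (b m) z, fun z => ?_, fun z => ?_⟩
  · have h := (hloc (‖z‖ + 1)).tendstoLocallyUniformlyOn_finsetRange.differentiableOn
      (Eventually.of_forall fun R => ?_) Metric.isOpen_ball
    · exact h.differentiableAt (Metric.isOpen_ball.mem_nhds (by simp))
    · exact (DifferentiableOn.fun_finsetProd fun m _ => (differentiable_pairFactor _ _).differentiableOn)
  · exact ((hloc (‖z‖ + 1)).hasProd (by simp)).tendsto_prod_nat

/-! ### Entire functions vanishing on a separated set. -/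

-- Each block `[m, m + 1)` holds at most one point of `S`; an empty block is given the dummy zero `m
-- + 1`.
open Classical in
lemma exists_block_points {S : Set ℝ} (hS : ∀ s ∈ S, ∀ t ∈ S, s ≠ t → 1 ≤ |s - t|) {ρ : ℝ}
    (hρ1 : ρ ≤ 1) (hρ : ∀ s ∈ S, ρ ≤ |s|) :
    ∃ a : ℕ → ℝ, (∀ m : ℕ, (m : ℝ) ≤ a m ∧ a m ≤ (m : ℝ) + 1) ∧ ρ ≤ a 0 ∧
      (a 0 ∈ S ∨ a 0 = 1) ∧ ∀ s ∈ S, 0 < s → ∃ m, a m = s := by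
  set a : ℕ → ℝ := fun m =>
    if h : ∃ s ∈ S, (m : ℝ) ≤ s ∧ s < (m : ℝ) + 1 then h.choose else (m : ℝ) + 1 with ha
  have key : ∀ m, (a m ∈ S ∧ (m : ℝ) ≤ a m ∧ a m < (m : ℝ) + 1) ∨
      (a m = (m : ℝ) + 1 ∧ ¬ ∃ s ∈ S, (m : ℝ) ≤ s ∧ s < (m : ℝ) + 1) := by
    intro m
    by_cases h : ∃ s ∈ S, (m : ℝ) ≤ s ∧ s < (m : ℝ) + 1
    · left; simp only [ha, dif_pos h]; exact h.choose_spec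
    · right; exact ⟨by simp only [ha, dif_neg h], h⟩
  refine ⟨a, fun m => ?_, ?_, ?_, fun s hs hs0 => ?_⟩
  · rcases key m with h | h
    · exact ⟨h.2.1, h.2.2.le⟩
    · rw [h.1]; constructor <;> linarith
  · rcases key 0 with h | h
    · have h0 : 0 ≤ a 0 := by simpa using h.2.1
      exact (hρ _ h.1).trans_eq (abs_of_nonneg h0)
    · rw [h.1]; simpa using hρ1
  · rcases key 0 with h | h
    · exact Or.inl h.1
    · right; simpa using h.1
  · have hf1 := Nat.floor_le hs0.le
    have hf2 := Nat.lt_floor_add_one s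
    refine ⟨⌊s⌋₊, ?_⟩
    rcases key ⌊s⌋₊ with h | h
    · by_contra hne
      have := hS _ h.1 _ hs hne
      have h' : |a ⌊s⌋₊ - s| < 1 := abs_lt.2 ⟨by linarith [h.2.1], by linarith [h.2.2]⟩
      linarith
    · exact absurd ⟨s, hs, hf1, hf2⟩ h.2

lemma norm_one_sub_inv_mul_le {a : ℝ} (h0 : 0 < a) (h1 : a ≤ 1) (z : ℂ) :
    ‖1 - ((a⁻¹ : ℝ) : ℂ) * z‖ ≤ a⁻¹ * (2 + ‖z‖) := by
  refine (norm_sub_le _ _).trans ?_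
  rw [norm_one, norm_mul, Complex.norm_real, Real.norm_of_nonneg (inv_nonneg.2 h0.le), mul_add]
  have := (one_le_inv₀ h0).2 h1
  linarith

/-- A `1`-separated set of reals avoiding `(-ρ, ρ)` lies in the zero set of an entire function `H`
with `H 0 = 1`, of exponential type `π` and of polynomial growth on the real line. -/
theorem exists_entire_vanishing_on_separated {S : Set ℝ}
    (hS : ∀ s ∈ S, ∀ t ∈ S, s ≠ t → 1 ≤ |s - t|) {ρ : ℝ}
    (hρ0 : 0 < ρ) (hρ1 : ρ ≤ 1) (hρ : ∀ s ∈ S, ρ ≤ |s|) :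
    ∃ H : ℂ → ℂ, Differentiable ℂ H ∧ H 0 = 1 ∧ (∀ s ∈ S, H (s : ℂ) = 0) ∧
      ∀ z, ‖H z‖ ≤ 2 * Real.exp Real.pi * ρ⁻¹ * (2 + ‖z‖) ^ 4 * Real.exp (Real.pi * |z.im|) := by
  obtain ⟨a, ha, ha0, haS, haz⟩ := exists_block_points hS hρ1 hρ
  obtain ⟨b, hb, hb0, hbS, hbz⟩ := exists_block_points (S := {s | -s ∈ S})
    (fun s hs t ht hst => by
      have := hS _ hs _ ht (by simpa using hst)
      rwa [← abs_neg, neg_sub, sub_neg_eq_add, neg_add_eq_sub] at this)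
    hρ1 (fun s hs => by simpa using hρ _ hs)
  have ha1 : ∀ m : ℕ, (m : ℝ) + 1 ≤ a (m + 1) ∧ a (m + 1) ≤ (m : ℝ) + 2 := fun m => by
    have := ha (m + 1); push_cast at this; exact ⟨this.1, by linarith [this.2]⟩
  have hb1 : ∀ m : ℕ, (m : ℝ) + 1 ≤ b (m + 1) ∧ b (m + 1) ≤ (m : ℝ) + 2 := fun m => by
    have := hb (m + 1); push_cast at this; exact ⟨this.1, by linarith [this.2]⟩
  obtain ⟨H, hHd, hH⟩ := exists_tendsto_prod_pairFactor ha1 hb1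
  have hapos : ∀ m, 0 < a m := fun m => by
    cases m with
    | zero => linarith
    | succ m => exact lt_of_lt_of_le (by positivity) (ha1 m).1
  have hbpos : ∀ m, 0 < b m := fun m => by
    cases m with
    | zero => linarith
    | succ m => exact lt_of_lt_of_le (by positivity) (hb1 m).1
  have hzero : ∀ (m : ℕ) (z : ℂ), pairFactor (a m) (b m) z = 0 →
      pairFactor (a 0) (b 0) z * H z = 0 := fun m z hz => by
    cases m with
    | zero => rw [hz, zero_mul]
    | succ m =>
      suffices H z = 0 by rw [this, mul_zero]
      refine tendsto_nhds_unique (hH z) (tendsto_const_nhds.congr' ?_)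
      filter_upwards [eventually_gt_atTop m] with R hR
      exact (Finset.prod_eq_zero (Finset.mem_range.2 hR) hz).symm
  refine ⟨fun z => pairFactor (a 0) (b 0) z * H z, (differentiable_pairFactor _ _).mul hHd, ?_,
    fun s hs => ?_, fun z => ?_⟩
  · have : H 0 = 1 := tendsto_nhds_unique (hH 0) (by simp [pairFactor])
    simp [this, pairFactor]
  · rcases lt_trichotomy s 0 with h | h | h
    · obtain ⟨m, hm⟩ := hbz (-s) (by simpa using hs) (by linarith)
      refine hzero m _ ?_
      rw [pairFactor, hm]
      have : (s : ℂ) ≠ 0 := by exact_mod_cast h.ne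
      push_cast
      field_simp
      simp
    · have := hρ s hs
      rw [h, abs_zero] at this
      linarith
    · obtain ⟨m, hm⟩ := haz s hs h
      refine hzero m _ ?_
      rw [pairFactor, hm]
      have : (s : ℂ) ≠ 0 := by exact_mod_cast h.ne'
      push_cast
      field_simp
      simp
  -- Only one power of `ρ` is lost: if `a 0` and `-b 0` both lie in `S` they are at least 1 apart,
  -- so one of `a 0`, `b 0` is at least `1/2`.
  · have hab : ρ / 2 ≤ a 0 * b 0 := by
      have ha2 : a 0 ≤ 1 := by simpa using (ha 0).2
      have hb2 : b 0 ≤ 1 := by simpa using (hb 0).2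
      rcases haS with h1 | h1
      · rcases hbS with h2 | h2
        · have := hS _ h1 _ h2 (by linarith)
          rw [sub_neg_eq_add, abs_of_pos (by linarith)] at this
          nlinarith
        · rw [h2]; linarith
      · rw [h1]; linarith
    have hinv : (a 0)⁻¹ * (b 0)⁻¹ ≤ 2 * ρ⁻¹ := by
      rw [← mul_inv]
      refine (inv_anti₀ (by positivity) hab).trans_eq ?_
      rw [inv_div, div_eq_mul_inv]
    have h1 := norm_one_sub_inv_mul_le (hapos 0) (by simpa using (ha 0).2) z
    have h2 := norm_one_sub_inv_mul_le (hbpos 0) (by simpa using (hb 0).2) (-z)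
    rw [norm_neg] at h2
    have h3 := norm_lim_pairFactor_le ha1 hb1 (hH z)
    have h12 : ‖pairFactor (a 0) (b 0) z‖ ≤ 2 * ρ⁻¹ * (2 + ‖z‖) ^ 2 := by
      rw [pairFactor, norm_mul]
      refine (mul_le_mul h1 h2 (norm_nonneg _) (mul_nonneg (inv_nonneg.2 (hapos 0).le)
        (by positivity))).trans ?_
      rw [mul_mul_mul_comm, ← sq]
      exact mul_le_mul_of_nonneg_right hinv (by positivity)
    rw [norm_mul]
    refine (mul_le_mul h12 h3 (norm_nonneg _) (by positivity)).trans_eq ?_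
    rw [mul_add, mul_one, Real.exp_add]
    ring

/-! ### Paley–Wiener functions and their Fourier transforms. -/

/-- Entire functions of exponential type `2πτ` decaying quadratically on horizontal lines. -/
def IsPaleyWiener (τ : ℝ) (G : ℂ → ℂ) : Prop :=
  Differentiable ℂ G ∧
    ∃ A, ∀ z, ‖G z‖ ≤ A * ((1 + ‖z‖ ^ 2)⁻¹ * Real.exp (2 * Real.pi * τ * |z.im|))

namespace IsPaleyWiener

variable {τ : ℝ} {G : ℂ → ℂ}

lemma sum {ι : Type*} {F : ι → ℂ → ℂ} (s : Finset ι) (hF : ∀ i ∈ s, IsPaleyWiener τ (F i)) :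
    IsPaleyWiener τ fun z => ∑ i ∈ s, F i z := by
  have h : ∀ i, ∃ A, i ∈ s → ∀ z,
      ‖F i z‖ ≤ A * ((1 + ‖z‖ ^ 2)⁻¹ * Real.exp (2 * Real.pi * τ * |z.im|)) := fun i => by
    by_cases hi : i ∈ s
    · obtain ⟨A, hA⟩ := (hF i hi).2
      exact ⟨A, fun _ => hA⟩
    · exact ⟨0, fun hi' => absurd hi' hi⟩
  choose A hA using h
  refine ⟨Differentiable.fun_sum fun i hi => (hF i hi).1, ∑ i ∈ s, A i, fun z => ?_⟩
  rw [Finset.sum_mul]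
  exact norm_sum_le_of_le _ fun i hi => hA i hi z

lemma continuous_ofReal (hG : IsPaleyWiener τ G) : Continuous fun x : ℝ => G x :=
  hG.1.continuous.comp Complex.continuous_ofReal

lemma exists_norm_le_ofReal (hG : IsPaleyWiener τ G) :
    ∃ A, ∀ x : ℝ, ‖G x‖ ≤ A * (1 + x ^ 2)⁻¹ := by
  obtain ⟨A, hA⟩ := hG.2
  refine ⟨A, fun x => (hA x).trans_eq ?_⟩
  simp

lemma integrable_ofReal (hG : IsPaleyWiener τ G) : Integrable fun x : ℝ => G x := by
  obtain ⟨A, hA⟩ := hG.exists_norm_le_ofReal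
  exact (integrable_inv_one_add_sq.const_mul A).mono' hG.continuous_ofReal.aestronglyMeasurable
    (ae_of_all _ hA)

end IsPaleyWiener

/-- Shifting the contour of integration from the real line to a parallel line. -/
lemma integral_eq_integral_add_mul_I {Φ : ℂ → ℂ} (hΦ : Differentiable ℂ Φ) {B η : ℝ}
    (hB : ∀ z : ℂ, |z.im| ≤ |η| → ‖Φ z‖ ≤ B * (1 + z.re ^ 2)⁻¹) :
    ∫ x : ℝ, Φ x = ∫ x : ℝ, Φ (x + η * Complex.I) := by
  have hint : ∀ y : ℝ, |y| ≤ |η| → Integrable fun x : ℝ => Φ (x + y * Complex.I) := fun y hy => by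
    refine (integrable_inv_one_add_sq.const_mul B).mono'
      (hΦ.continuous.comp (by fun_prop)).aestronglyMeasurable (ae_of_all _ fun x => ?_)
    simpa using hB (x + y * Complex.I) (by simpa using hy)
  have hl0 := intervalIntegral_tendsto_integral (hint 0 (by simp)) tendsto_neg_atTop_atBot tendsto_id
  have hl1 := intervalIntegral_tendsto_integral (hint η le_rfl) tendsto_neg_atTop_atBot tendsto_id
  have hvert : ∀ σ : ℝ, |σ| = 1 → Tendsto (fun T : ℝ =>
      Complex.I * ∫ y : ℝ in (0 : ℝ)..η, Φ ((σ * T : ℝ) + y * Complex.I)) atTop (𝓝 0) := by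
    intro σ hσ
    refine squeeze_zero_norm (a := fun T : ℝ => B * (1 + T ^ 2)⁻¹ * |η|) (fun T => ?_) ?_
    · rw [norm_mul, Complex.norm_I, one_mul]
      refine (intervalIntegral.norm_integral_le_of_norm_le_const (C := B * (1 + T ^ 2)⁻¹)
        fun y hy => ?_).trans_eq (by rw [sub_zero])
      refine (hB _ ?_).trans_eq ?_
      · simp only [Complex.add_im, Complex.ofReal_im, Complex.mul_im, Complex.ofReal_re,
          Complex.I_im, mul_one, Complex.I_re, mul_zero, add_zero, zero_add]
        have := Set.abs_sub_left_of_mem_uIcc (Set.uIoc_subset_uIcc hy)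
        simpa using this
      · simp [mul_pow, ← sq_abs σ, hσ]
    · have h1 : Tendsto (fun T : ℝ => (1 + T ^ 2)⁻¹) atTop (𝓝 0) :=
        (tendsto_atTop_add_const_left _ _ (tendsto_pow_atTop two_ne_zero)).inv_tendsto_atTop
      simpa using (h1.const_mul B).mul_const |η|
  have hrect : ∀ T : ℝ, (∫ x : ℝ in -T..T, Φ (x + (0 : ℝ) * Complex.I)) -
      (∫ x : ℝ in -T..T, Φ (x + η * Complex.I)) =
      Complex.I * (∫ y : ℝ in (0 : ℝ)..η, Φ ((-1 * T : ℝ) + y * Complex.I)) -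
      Complex.I * (∫ y : ℝ in (0 : ℝ)..η, Φ ((1 * T : ℝ) + y * Complex.I)) := fun T => by
    have := Complex.integral_boundary_rect_eq_zero_of_differentiableOn Φ (-T) (T + η * Complex.I)
      hΦ.differentiableOn
    simp only [Complex.neg_re, Complex.ofReal_re, Complex.add_re, Complex.mul_re, Complex.I_re,
      mul_zero, Complex.ofReal_im, Complex.I_im, mul_one, sub_self, add_zero, Complex.neg_im,
      neg_zero, Complex.add_im, Complex.mul_im, zero_add, smul_eq_mul] at this
    simp only [neg_one_mul, one_mul]
    linear_combination this
  have hlim := (hvert (-1) (by simp)).sub (hvert 1 (by simp))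
  have := tendsto_nhds_unique ((hl0.sub hl1).congr fun T => hrect T) hlim
  rw [sub_zero, sub_eq_zero] at this
  simpa using this

namespace IsPaleyWiener

variable {τ : ℝ} {G : ℂ → ℂ}

lemma norm_fourier_le {A : ℝ} (hd : Differentiable ℂ G) (hτ : 0 ≤ τ)
    (hA : ∀ z, ‖G z‖ ≤ A * ((1 + ‖z‖ ^ 2)⁻¹ * Real.exp (2 * Real.pi * τ * |z.im|))) (ξ η : ℝ) :
    ‖𝓕 (fun x : ℝ => G x) ξ‖ ≤
      A * Real.pi * Real.exp (2 * Real.pi * (η * ξ + τ * |η|)) := by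
  have hA0 : 0 ≤ A := by simpa using (norm_nonneg _).trans (hA 0)
  set Φ : ℂ → ℂ := fun z => Complex.exp (-2 * Real.pi * z * ξ * Complex.I) * G z with hΦ
  have hΦd : Differentiable ℂ Φ := by
    have : Differentiable ℂ G := hd
    simp only [hΦ]
    fun_prop
  have hΦn : ∀ z : ℂ, ‖Φ z‖ ≤ A * Real.exp (2 * Real.pi * (z.im * ξ + τ * |z.im|)) *
      (1 + z.re ^ 2)⁻¹ := fun z => by
    have h1 : ‖Complex.exp (-2 * Real.pi * z * ξ * Complex.I)‖ =
        Real.exp (2 * Real.pi * (z.im * ξ)) := by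
      rw [Complex.norm_exp]
      congr 1
      simp
      ring
    have h2 : (1 + ‖z‖ ^ 2)⁻¹ ≤ (1 + z.re ^ 2)⁻¹ := by
      refine inv_anti₀ (by positivity) ?_
      have := sq_le_sq' (by linarith [Complex.abs_re_le_norm z, neg_abs_le z.re])
        ((le_abs_self _).trans (Complex.abs_re_le_norm z))
      linarith
    simp only [hΦ]
    rw [norm_mul, h1, mul_add, Real.exp_add]
    calc _ ≤ Real.exp (2 * Real.pi * (z.im * ξ)) *
          (A * ((1 + z.re ^ 2)⁻¹ * Real.exp (2 * Real.pi * τ * |z.im|))) := by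
          gcongr
          exact (hA z).trans (by gcongr)
      _ = _ := by rw [← mul_assoc (2 * Real.pi) τ]; ring
  have hshift := integral_eq_integral_add_mul_I hΦd (η := η)
    (B := A * Real.exp (2 * Real.pi * (|η| * |ξ| + τ * |η|))) fun z hz => by
      refine (hΦn z).trans ?_
      have : z.im * ξ ≤ |η| * |ξ| := (le_abs_self _).trans (by
        rw [abs_mul]; exact mul_le_mul_of_nonneg_right hz (abs_nonneg _))
      gcongr
  have hF : 𝓕 (fun x : ℝ => G x) ξ = ∫ x : ℝ, Φ x := by
    rw [Real.fourier_real_eq_integral_exp_smul]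
    refine integral_congr_ae (ae_of_all _ fun x => ?_)
    simp [hΦ]
  rw [hF, hshift]
  refine (norm_integral_le_of_norm_le (integrable_inv_one_add_sq.const_mul
    (A * Real.exp (2 * Real.pi * (η * ξ + τ * |η|)))) (ae_of_all _ fun x => ?_)).trans_eq ?_
  · simpa using hΦn (x + η * Complex.I)
  · rw [integral_const_mul, integral_univ_inv_one_add_sq]
    ring

/-- Shifting the contour to height `R`, on the side opposite to the sign of `ξ`, bounds the
transform by a constant times `exp (2πR(τ - |ξ|))`, which tends to 0. -/
lemma fourier_eq_zero (hG : IsPaleyWiener τ G) (hτ : 0 ≤ τ) {ξ : ℝ} (hξ : τ < |ξ|) :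
    𝓕 (fun x : ℝ => G x) ξ = 0 := by
  obtain ⟨hd, A, hA⟩ := hG
  have hlim : Tendsto (fun R : ℝ => A * Real.pi * Real.exp (2 * Real.pi * (R * (τ - |ξ|))))
      atTop (𝓝 0) := by
    have h1 : Tendsto (fun R : ℝ => R * (τ - |ξ|)) atTop atBot :=
      tendsto_id.atTop_mul_const_of_neg (by linarith)
    have h2 := Real.tendsto_exp_atBot.comp (h1.const_mul_atBot Real.two_pi_pos)
    simpa using h2.const_mul (A * Real.pi)
  refine norm_le_zero_iff.1 (ge_of_tendsto hlim ?_)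
  filter_upwards [eventually_ge_atTop 0] with R hR
  rcases abs_cases ξ with ⟨h, -⟩ | ⟨h, -⟩
  · refine (norm_fourier_le hd hτ hA ξ (-R)).trans_eq ?_
    rw [abs_neg, abs_of_nonneg hR, h]
    ring_nf
  · refine (norm_fourier_le hd hτ hA ξ R).trans_eq ?_
    rw [abs_of_nonneg hR, h]
    ring_nf

lemma continuous_fourier (hG : IsPaleyWiener τ G) : Continuous (𝓕 fun x : ℝ => G x) :=
  VectorFourier.fourierIntegral_continuous Real.continuous_fourierChar
    (innerSL ℝ).continuous₂ hG.integrable_ofReal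

lemma hasCompactSupport_fourier (hG : IsPaleyWiener τ G) (hτ : 0 ≤ τ) :
    HasCompactSupport (𝓕 fun x : ℝ => G x) := by
  refine HasCompactSupport.intro (isCompact_Icc (a := -τ) (b := τ)) fun ξ hξ =>
    hG.fourier_eq_zero hτ ?_
  by_contra! h
  exact hξ (abs_le.1 h)

lemma integrable_fourier (hG : IsPaleyWiener τ G) (hτ : 0 ≤ τ) :
    Integrable (𝓕 fun x : ℝ => G x) :=
  hG.continuous_fourier.integrable_of_hasCompactSupport (hG.hasCompactSupport_fourier hτ)

lemma memLp_fourier (hG : IsPaleyWiener τ G) (hτ : 0 ≤ τ) :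
    MemLp (𝓕 fun x : ℝ => G x) 2 :=
  hG.continuous_fourier.memLp_of_hasCompactSupport (hG.hasCompactSupport_fourier hτ)

lemma fourierInv_fourier (hG : IsPaleyWiener τ G) (hτ : 0 ≤ τ) :
    𝓕⁻ (𝓕 fun x : ℝ => G x) = fun x : ℝ => G x :=
  hG.continuous_ofReal.fourierInv_fourier_eq hG.integrable_ofReal (hG.integrable_fourier hτ)

lemma integral_exp_mul_fourier (hG : IsPaleyWiener τ G) (hτ : 0 ≤ τ) (x : ℝ) :
    ∫ ξ : ℝ, Complex.exp (2 * Real.pi * x * ξ * Complex.I) * 𝓕 (fun x : ℝ => G x) ξ = G x := by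
  have h := congrFun (hG.fourierInv_fourier hτ) x
  rw [Real.fourierInv_eq'] at h
  rw [← h]
  refine integral_congr_ae (ae_of_all _ fun ξ => ?_)
  simp [mul_assoc]

lemma integral_norm_sq_fourier (hG : IsPaleyWiener τ G) (hτ : 0 ≤ τ) :
    ∫ ξ : ℝ, ‖𝓕 (fun x : ℝ => G x) ξ‖ ^ 2 = ∫ x : ℝ, ‖G x‖ ^ 2 := by
  have h := VectorFourier.integral_sesq_fourierIntegral_eq_neg_flip (innerSL ℂ (E := ℂ))
    (L := innerₗ ℝ) Real.continuous_fourierChar continuous_inner hG.integrable_ofReal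
    (hG.integrable_fourier hτ)
  have h2 : ∫ ξ : ℝ, inner ℂ (𝓕 (fun x : ℝ => G x) ξ) (𝓕 (fun x : ℝ => G x) ξ) =
      ∫ x : ℝ, inner ℂ (G x) (𝓕⁻ (𝓕 fun x : ℝ => G x) x) := by
    rw [flip_innerₗ] at h
    exact h
  rw [hG.fourierInv_fourier hτ] at h2
  apply Complex.ofRealLI.injective
  simpa [← LinearIsometry.integral_comp_comm, inner_self_eq_norm_sq_to_K] using h2

end IsPaleyWiener

/-! ### Square-summable superposition. -/

/-- Cauchy–Schwarz with weights `w k = (1 + (x - p k)²)⁻¹` gives `(∑ κ w)² ≤ (∑ w)(∑ κ² w) ≤ B ∑ κ²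
w`, and each `w k` has integral `π`. -/
lemma integral_norm_sq_sum_le {ι : Type*} {G : ι → ℝ → ℂ} {p κ : ι → ℝ} {B : ℝ}
    (hGb : ∀ k x, ‖G k x‖ ≤ κ k * (1 + (x - p k) ^ 2)⁻¹)
    (hB : ∀ (s : Finset ι) (x : ℝ), ∑ k ∈ s, (1 + (x - p k) ^ 2)⁻¹ ≤ B) (s : Finset ι) :
    ∫ x : ℝ, ‖∑ k ∈ s, G k x‖ ^ 2 ≤ B * Real.pi * ∑ k ∈ s, κ k ^ 2 := by
  have hw : ∀ k, Integrable fun x : ℝ => (1 + (x - p k) ^ 2)⁻¹ := fun k =>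
    integrable_inv_one_add_sq.comp_sub_right (p k)
  have hwi : ∀ k, ∫ x : ℝ, (1 + (x - p k) ^ 2)⁻¹ = Real.pi := fun k => by
    rw [integral_sub_right_eq_self (fun x : ℝ => (1 + x ^ 2)⁻¹), integral_univ_inv_one_add_sq]
  have hpt : ∀ x, ‖∑ k ∈ s, G k x‖ ^ 2 ≤ B * ∑ k ∈ s, κ k ^ 2 * (1 + (x - p k) ^ 2)⁻¹ := fun x => by
    have h1 : ‖∑ k ∈ s, G k x‖ ≤ ∑ k ∈ s, κ k * (1 + (x - p k) ^ 2)⁻¹ :=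
      norm_sum_le_of_le _ fun k _ => hGb k x
    have h2 := Finset.sum_sq_le_sum_mul_sum_of_sq_le_mul s
      (r := fun k => κ k * (1 + (x - p k) ^ 2)⁻¹) (f := fun k => κ k ^ 2 * (1 + (x - p k) ^ 2)⁻¹)
      (g := fun k => (1 + (x - p k) ^ 2)⁻¹) (fun k _ => by positivity) (fun k _ => by positivity)
      (fun k _ => by apply le_of_eq; ring)
    refine (pow_le_pow_left₀ (norm_nonneg _) h1 2).trans (h2.trans ?_)
    rw [mul_comm]
    exact mul_le_mul_of_nonneg_right (hB s x) (Finset.sum_nonneg fun k _ => by positivity)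
  have hint : Integrable fun x : ℝ => B * ∑ k ∈ s, κ k ^ 2 * (1 + (x - p k) ^ 2)⁻¹ :=
    (integrable_finsetSum _ fun k _ => (hw k).const_mul _).const_mul _
  calc ∫ x : ℝ, ‖∑ k ∈ s, G k x‖ ^ 2
      ≤ ∫ x : ℝ, B * ∑ k ∈ s, κ k ^ 2 * (1 + (x - p k) ^ 2)⁻¹ := by
        refine integral_mono_of_nonneg (ae_of_all _ fun x => by positivity) hint (ae_of_all _ hpt)
    _ = B * Real.pi * ∑ k ∈ s, κ k ^ 2 := by
        rw [integral_const_mul, integral_finsetSum _ fun k _ => (hw k).const_mul _]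
        simp_rw [integral_const_mul, hwi]
        rw [← Finset.sum_mul]
        ring

lemma MeasureTheory.L2.norm_sq_eq_integral {α : Type*} [MeasurableSpace α] {μ : Measure α}
    (f : Lp ℂ 2 μ) : ‖f‖ ^ 2 = ∫ a, ‖f a‖ ^ 2 ∂μ := by
  have h : inner ℂ f f = ∫ a, inner ℂ (f a) (f a) ∂μ := L2.inner_def f f
  apply Complex.ofRealLI.injective
  simpa [← LinearIsometry.integral_comp_comm, inner_self_eq_norm_sq_to_K] using h

lemma IsPaleyWiener.fourier_sum {ι : Type*} {τ : ℝ} {G : ι → ℂ → ℂ}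
    (hG : ∀ k, IsPaleyWiener τ (G k)) (s : Finset ι) (ξ : ℝ) :
    𝓕 (fun x : ℝ => ∑ k ∈ s, G k x) ξ = ∑ k ∈ s, 𝓕 (fun x : ℝ => G k x) ξ := by
  simp only [Real.fourier_real_eq, Finset.smul_sum]
  refine integral_finsetSum _ fun k _ => ?_
  have := (Real.fourierIntegral_convergent_iff ξ).2 (hG k).integrable_ofReal
  simpa [mul_comm] using this

/-- Superposition of Paley–Wiener functions with almost disjoint profiles: the sum is again the
Fourier transform of a square integrable function with the same support. -/
theorem exists_memLp_hasSum_integral_exp {ι : Type*} {τ : ℝ} (hτ : 0 ≤ τ) {G : ι → ℂ → ℂ}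
    {p κ : ι → ℝ} {B : ℝ} (hG : ∀ k, IsPaleyWiener τ (G k))
    (hGb : ∀ k (x : ℝ), ‖G k x‖ ≤ κ k * (1 + (x - p k) ^ 2)⁻¹)
    (hB : ∀ (s : Finset ι) (x : ℝ), ∑ k ∈ s, (1 + (x - p k) ^ 2)⁻¹ ≤ B)
    (hκ : Summable fun k => κ k ^ 2) :
    ∃ V : ℝ → ℂ, MemLp V 2 ∧ (∀ ξ, ξ ∉ Set.Icc (-τ) τ → V ξ = 0) ∧ ∀ x : ℝ,
      HasSum (fun k => G k x) (∫ ξ : ℝ, Complex.exp (2 * Real.pi * x * ξ * Complex.I) * V ξ) := by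
  set v : ι → Lp ℂ 2 (volume : Measure ℝ) := fun k => ((hG k).memLp_fourier hτ).toLp with hv
  have hB0 : 0 ≤ B := by simpa using hB ∅ 0
  have hvn : ∀ s : Finset ι, ‖∑ k ∈ s, v k‖ ^ 2 ≤ B * Real.pi * ∑ k ∈ s, κ k ^ 2 := fun s => by
    rw [L2.norm_sq_eq_integral]
    have hae : ∀ᵐ ξ : ℝ, ∀ k ∈ s, v k ξ = 𝓕 (fun x : ℝ => G k x) ξ :=
      (ae_ball_iff s.countable_toSet).2 fun k _ => ((hG k).memLp_fourier hτ).coeFn_toLp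
    have h1 : ∫ ξ : ℝ, ‖(∑ k ∈ s, v k : Lp ℂ 2 (volume : Measure ℝ)) ξ‖ ^ 2 =
        ∫ ξ : ℝ, ‖𝓕 (fun x : ℝ => ∑ k ∈ s, G k x) ξ‖ ^ 2 := by
      refine integral_congr_ae ?_
      filter_upwards [hae, Lp.coeFn_finsetSum s v] with ξ h2 h3
      rw [h3, IsPaleyWiener.fourier_sum hG, Finset.sum_apply, Finset.sum_congr rfl h2]
    rw [h1, (IsPaleyWiener.sum s fun k _ => hG k).integral_norm_sq_fourier hτ]
    exact integral_norm_sq_sum_le hGb hB s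
  have hsum : Summable v := by
    refine summable_iff_vanishing_norm.2 fun ε hε => ?_
    obtain ⟨s, hs⟩ := summable_iff_vanishing_norm.1 hκ (ε ^ 2 / (B * Real.pi + 1))
      (by have := Real.pi_pos; positivity)
    refine ⟨s, fun t ht => ?_⟩
    have h1 := hs t ht
    rw [Real.norm_of_nonneg (Finset.sum_nonneg fun k _ => sq_nonneg _),
      lt_div_iff₀ (by have := Real.pi_pos; positivity)] at h1
    have h2 : 0 ≤ ∑ k ∈ t, κ k ^ 2 := Finset.sum_nonneg fun k _ => sq_nonneg _
    exact lt_of_pow_lt_pow_left₀ 2 hε.le ((hvn t).trans_lt (by linarith))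
  set V := ∑' k, v k
  -- On a bounded interval the exponential is square integrable, so the moment at `x` is a
  -- continuous functional and carries `L²` convergence to convergence at every point `x`.
  have hfun : ∀ x : ℝ, ∃ e : Lp ℂ 2 (volume : Measure ℝ), ∀ f : Lp ℂ 2 (volume : Measure ℝ),
      inner ℂ e f = ∫ ξ : ℝ, Complex.exp (2 * Real.pi * x * ξ * Complex.I) *
        (Set.Icc (-τ) τ).indicator f ξ := fun x => by
    have hmem : MemLp ((Set.Icc (-τ) τ).indicator fun ξ : ℝ =>
        Complex.exp (-(2 * Real.pi * x * ξ * Complex.I))) 2 := by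
      rw [memLp_indicator_iff_restrict measurableSet_Icc]
      have hc : Continuous fun ξ : ℝ => Complex.exp (-(2 * Real.pi * x * ξ * Complex.I)) := by
        fun_prop
      exact (memLp_top_of_bound hc.aestronglyMeasurable 1 (ae_of_all _ fun ξ => by
        rw [Complex.norm_exp]; simp)).mono_exponent le_top
    refine ⟨hmem.toLp, fun f => ?_⟩
    rw [L2.inner_def]
    refine integral_congr_ae ?_
    filter_upwards [hmem.coeFn_toLp] with ξ hξ
    rw [hξ]
    by_cases h : ξ ∈ Set.Icc (-τ) τ
    · simp only [Set.indicator_of_mem h, RCLike.inner_apply, ← Complex.exp_conj]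
      simp [mul_comm, Complex.conj_ofNat]
    · simp [Set.indicator_of_notMem h]
  refine ⟨(Set.Icc (-τ) τ).indicator V, (Lp.memLp V).indicator measurableSet_Icc,
    fun ξ hξ => Set.indicator_of_notMem hξ _, fun x => ?_⟩
  obtain ⟨e, he⟩ := hfun x
  rw [← he]
  have hGx : ∀ k, inner ℂ e (v k) = G k x := fun k => by
    rw [he, ← (hG k).integral_exp_mul_fourier hτ x]
    refine integral_congr_ae ?_
    filter_upwards [((hG k).memLp_fourier hτ).coeFn_toLp] with ξ hξ
    congr 1
    by_cases h : ξ ∈ Set.Icc (-τ) τ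
    · rw [Set.indicator_of_mem h, hξ]
    · rw [Set.indicator_of_notMem h, (hG k).fourier_eq_zero hτ]
      by_contra! h'
      exact h (abs_le.1 h')
  simpa [hGx] using hsum.hasSum.mapL (innerSL ℂ e)

/-! ### Decaying multipliers and rescaling. -/

lemma differentiable_dslope_sin : Differentiable ℂ (dslope Complex.sin 0) := by
  rw [← differentiableOn_univ, Complex.differentiableOn_dslope univ_mem]
  exact Complex.differentiable_sin.differentiableOn

lemma exists_norm_dslope_sin_le : ∃ K : ℝ, 0 ≤ K ∧ ∀ z : ℂ,
    ‖dslope Complex.sin 0 z‖ ≤ K * (1 + ‖z‖)⁻¹ * Real.exp |z.im| := by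
  have hd := differentiable_dslope_sin
  obtain ⟨K, hK⟩ := (isCompact_closedBall (0 : ℂ) 1).exists_bound_of_continuousOn
    hd.continuous.continuousOn
  refine ⟨2 * max K 1, by positivity, fun z => ?_⟩
  have hexp : 1 ≤ Real.exp |z.im| := Real.one_le_exp (abs_nonneg _)
  have hz : 0 < 1 + ‖z‖ := by positivity
  rcases le_total ‖z‖ 1 with h | h
  · refine (hK z (by simpa using h)).trans ((le_max_left K 1).trans ?_)
    refine le_trans ?_ (le_mul_of_one_le_right (by positivity) hexp)
    rw [← div_eq_mul_inv, le_div_iff₀ hz]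
    nlinarith [le_max_right K 1]
  · have hz0 : z ≠ 0 := norm_pos_iff.1 (by linarith)
    rw [dslope_of_ne _ hz0, slope_def_field, Complex.sin_zero, sub_zero, sub_zero, norm_div]
    have h1 : ‖z‖⁻¹ ≤ 2 * max K 1 * (1 + ‖z‖)⁻¹ := by
      rw [inv_le_iff_one_le_mul₀ (by linarith), mul_assoc, ← div_eq_inv_mul]
      have : 1 / 2 ≤ ‖z‖ / (1 + ‖z‖) := by
        rw [div_le_div_iff₀ two_pos hz]; linarith
      nlinarith [le_max_right K 1]
    rw [div_eq_inv_mul]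
    exact mul_le_mul h1 (norm_sin_le_exp z) (norm_nonneg _) (by positivity)

/-- Multipliers of arbitrarily small exponential type and polynomial decay of arbitrary order. -/
lemma exists_entire_decay (n : ℕ) {ε : ℝ} (hε : 0 < ε) :
    ∃ ψ : ℂ → ℂ, Differentiable ℂ ψ ∧ ψ 0 = 1 ∧ ∃ K : ℝ, 0 ≤ K ∧ ∀ z,
      ‖ψ z‖ ≤ K * ((1 + ‖z‖) ^ n)⁻¹ * Real.exp (ε * |z.im|) := by
  obtain ⟨K, hK0, hK⟩ := exists_norm_dslope_sin_le
  have hd := differentiable_dslope_sin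
  -- The multiplier is `(sin (ηz) / (ηz)) ^ n`, of type `nη ≤ ε`; the `n + 1` covers `n = 0`.
  set η : ℝ := ε / (n + 1) with hη
  have hη0 : 0 < η := by positivity
  refine ⟨fun z => dslope Complex.sin 0 (η * z) ^ n, (hd.comp (by fun_prop)).pow n, ?_,
    (K * (1 + η⁻¹)) ^ n, by positivity, fun z => ?_⟩
  · simp [Complex.deriv_sin]
  · have h1 : ‖dslope Complex.sin 0 (η * z)‖ ≤
        K * (1 + η⁻¹) * (1 + ‖z‖)⁻¹ * Real.exp (η * |z.im|) := by
      refine (hK _).trans ?_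
      rw [norm_mul, Complex.norm_real, Real.norm_of_nonneg hη0.le, Complex.im_ofReal_mul, abs_mul,
        abs_of_pos hη0]
      refine mul_le_mul_of_nonneg_right ?_ (by positivity)
      rw [mul_assoc]
      refine mul_le_mul_of_nonneg_left ?_ hK0
      rw [← div_eq_mul_inv, le_div_iff₀ (by positivity), ← div_eq_inv_mul,
        div_le_iff₀ (by positivity)]
      have : η⁻¹ * η = 1 := inv_mul_cancel₀ hη0.ne'
      have h3 : 0 < η⁻¹ := by positivity
      nlinarith [norm_nonneg z, mul_nonneg hη0.le (norm_nonneg z)]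
    rw [norm_pow]
    refine (pow_le_pow_left₀ (norm_nonneg _) h1 n).trans ?_
    rw [mul_pow, mul_pow, inv_pow, ← Real.exp_nat_mul]
    have h2 : (n : ℝ) * (η * |z.im|) ≤ ε * |z.im| := by
      rw [← mul_assoc]
      refine mul_le_mul_of_nonneg_right ?_ (abs_nonneg _)
      rw [hη, mul_div_assoc', div_le_iff₀ (by positivity)]
      nlinarith
    gcongr

/-- Translated and rescaled form of `exists_entire_vanishing_on_separated`. -/
lemma exists_entire_vanishing_on_separated_of_gap {g : ℝ} (hg : 0 < g) :
    ∃ c : ℝ, 0 < c ∧ ∀ (S : Set ℝ) (p ρ : ℝ), (∀ s ∈ S, ∀ t ∈ S, s ≠ t → g ≤ |s - t|) →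
      0 < ρ → ρ ≤ g → (∀ s ∈ S, ρ ≤ |s - p|) →
      ∃ H : ℂ → ℂ, Differentiable ℂ H ∧ H p = 1 ∧ (∀ s ∈ S, H (s : ℂ) = 0) ∧
        ∀ z, ‖H z‖ ≤ c * ρ⁻¹ * (1 + ‖z - p‖) ^ 4 * Real.exp (Real.pi / g * |z.im|) := by
  refine ⟨2 * Real.exp Real.pi * g * (2 + g⁻¹) ^ 4, by positivity, fun S p ρ hS hρ0 hρ1 hρ => ?_⟩
  obtain ⟨H, hd, h0, hz, hb⟩ := exists_entire_vanishing_on_separated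
    (S := (fun s => (s - p) / g) '' S) (ρ := ρ / g)
    (by
      rintro _ ⟨s, hs, rfl⟩ _ ⟨t, ht, rfl⟩ hst
      have := hS s hs t ht (by rintro rfl; exact hst rfl)
      rwa [← sub_div, sub_sub_sub_cancel_right, abs_div, abs_of_pos hg, one_le_div hg])
    (by positivity) ((div_le_one hg).2 hρ1)
    (by
      rintro _ ⟨s, hs, rfl⟩
      rw [abs_div, abs_of_pos hg]
      exact div_le_div_of_nonneg_right (hρ s hs) hg.le)
  refine ⟨fun z => H ((z - p) / g), hd.comp (by fun_prop), by simpa using h0, fun s hs => ?_,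
    fun z => ?_⟩
  · simpa using hz _ ⟨s, hs, rfl⟩
  · have him : |((z - p) / g : ℂ).im| = |z.im| / g := by
      rw [Complex.div_ofReal_im, abs_div, abs_of_pos hg]
      simp
    have hn : ‖((z - p) / g : ℂ)‖ = ‖z - p‖ / g := by
      rw [norm_div, Complex.norm_real, Real.norm_of_nonneg hg.le]
    have h2 : 2 + ‖z - p‖ / g ≤ (2 + g⁻¹) * (1 + ‖z - p‖) := by
      rw [div_eq_mul_inv]
      have : 0 < g⁻¹ := by positivity
      nlinarith [norm_nonneg (z - p)]
    refine (hb _).trans ?_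
    rw [him, hn, inv_div]
    calc _ ≤ 2 * Real.exp Real.pi * (g / ρ) * ((2 + g⁻¹) * (1 + ‖z - p‖)) ^ 4 *
          Real.exp (Real.pi * (|z.im| / g)) := by gcongr
      _ = _ := by rw [mul_pow, div_eq_mul_inv g]; ring_nf

/-! ### Interpolation at the nodes, one residue class at a time. -/

/-- Nodes `p k` whose `M`-th successors are `g`-separated. -/
structure IsNodeSequence (p : ℕ+ → ℝ) (M : ℕ+) (g : ℝ) : Prop where
  strictMono : StrictMono p
  map_one : p 1 = 0
  pos : 0 < g
  gap : ∀ k, p k + g ≤ p (k + M)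

namespace IsNodeSequence

variable {p : ℕ+ → ℝ} {M : ℕ+} {g : ℝ}

lemma nonneg (h : IsNodeSequence p M g) (k : ℕ+) : 0 ≤ p k :=
  h.map_one.symm.le.trans (h.strictMono.monotone (one_le))

lemma le_of_one_lt (h : IsNodeSequence p M g) {k : ℕ+} (hk : 1 < k) : p 2 ≤ p k :=
  h.strictMono.monotone (PNat.add_one_le_iff.2 hk)

lemma two_pos (h : IsNodeSequence p M g) : 0 < p 2 :=
  h.map_one ▸ h.strictMono (by decide)

lemma add_gap_le (h : IsNodeSequence p M g) {j k : ℕ+} (hjk : j < k)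
    (hmod : (j : ℕ) % M = (k : ℕ) % M) : p j + g ≤ p k := by
  refine (h.gap j).trans (h.strictMono.monotone ?_)
  rw [← PNat.coe_le_coe, PNat.add_coe]
  have h1 : (M : ℕ) ∣ k - j := (Nat.modEq_iff_dvd' hjk.le).1 hmod
  have h2 : (j : ℕ) < k := hjk
  have := Nat.le_of_dvd (by omega) h1
  omega

lemma gap_le_abs (h : IsNodeSequence p M g) {j k : ℕ+} (hjk : j ≠ k)
    (hmod : (j : ℕ) % M = (k : ℕ) % M) : g ≤ |p j - p k| := by
  rcases lt_or_gt_of_ne hjk with hlt | hlt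
  · rw [abs_sub_comm]
    exact (le_sub_iff_add_le'.2 (h.add_gap_le hlt hmod)).trans (le_abs_self _)
  · exact (le_sub_iff_add_le'.2 (h.add_gap_le hlt hmod.symm)).trans (le_abs_self _)

lemma gap_le_of_lt (h : IsNodeSequence p M g) {j : ℕ+} (hj : M < j) : g ≤ p j := by
  have := h.gap 1
  rw [h.map_one, zero_add, add_comm] at this
  exact this.trans (h.strictMono.monotone (PNat.add_one_le_iff.2 hj))

/-- The nodes with index congruent to `r`, and the reflections of all but the first of them. -/
def residueNodes (p : ℕ+ → ℝ) (M : ℕ+) (r : ℕ) : Set ℝ :=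
  {s | ∃ j : ℕ+, (j : ℕ) % M = r ∧ (s = p j ∨ s = -p j ∧ M < j)}

/-- A reflection `-p j` with `j > M` lies below `-g`, hence at distance at least `g` from all nodes.
The reflections with `j ≤ M` may be too close and are left to `exists_polynomial_factor`. -/
lemma residueNodes_separated (h : IsNodeSequence p M g) {r : ℕ} {s t : ℝ}
    (hs : s ∈ residueNodes p M r) (ht : t ∈ residueNodes p M r) (hst : s ≠ t) : g ≤ |s - t| := by
  obtain ⟨i, hi, rfl | ⟨rfl, hi'⟩⟩ := hs <;> obtain ⟨j, hj, rfl | ⟨rfl, hj'⟩⟩ := ht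
  · exact h.gap_le_abs (by rintro rfl; exact hst rfl) (hi.trans hj.symm)
  · rw [sub_neg_eq_add]
    exact (by linarith [h.nonneg i, h.gap_le_of_lt hj'] : g ≤ p i + p j).trans (le_abs_self _)
  · rw [abs_sub_comm, sub_neg_eq_add]
    exact (by linarith [h.nonneg j, h.gap_le_of_lt hi'] : g ≤ p j + p i).trans (le_abs_self _)
  · rw [neg_sub_neg]
    exact h.gap_le_abs (by rintro rfl; exact hst rfl) (hj.trans hi.symm)

/-- Uniform bound for the number of nodes near any point, weighted by inverse square distance. -/
lemma exists_sum_inv_one_add_sq_le (h : IsNodeSequence p M g) :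
    ∃ B : ℝ, ∀ (s : Finset ℕ+) (x : ℝ), ∑ k ∈ s, (1 + (x - p k) ^ 2)⁻¹ ≤ B := by
  have hg := h.pos
  set u : Fin M × ℤ → ℝ := fun q => 1 * (1 + (q.2 : ℝ) ^ 2)⁻¹ with hu
  have hnat : Summable fun n : ℕ => (1 + (n : ℝ) ^ 2)⁻¹ := by
    have h1 := ((summable_nat_add_iff 1).2
      (Real.summable_one_div_nat_pow.2 (by norm_num : 1 < 2))).mul_left 2
    refine Summable.of_nonneg_of_le (fun n => by positivity) (fun n => ?_) h1
    rw [mul_one_div, inv_eq_one_div, div_le_div_iff₀ (by positivity) (by positivity)]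
    push_cast
    nlinarith [sq_nonneg ((n : ℝ) - 1)]
  have hint : Summable fun n : ℤ => (1 + (n : ℝ) ^ 2)⁻¹ :=
    Summable.of_nat_of_neg (by simpa using hnat) (by simpa using hnat)
  have husum : Summable u :=
    Summable.mul_of_nonneg (f := fun _ : Fin M => (1 : ℝ)) (hasSum_fintype _).summable hint
      (fun _ => zero_le_one) (fun n => by positivity)
  refine ⟨3 * (1 + g⁻¹ ^ 2) * ∑' q, u q, fun s x => ?_⟩
  -- Each cell of length `g` holds at most one node of each class, so the sum is dominated by `M`
  -- copies of a convergent sum over `ℤ`.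
  set φ : ℕ+ → Fin M × ℤ := fun k => (⟨(k : ℕ) % M, Nat.mod_lt _ M.pos⟩, ⌊(p k - x) / g⌋) with hφ
  have hinj : Function.Injective φ := fun i j hij => by
    by_contra hne
    simp only [hφ, Prod.mk.injEq, Fin.mk.injEq] at hij
    have h1 := h.gap_le_abs hne hij.1
    have h2 := Int.abs_sub_lt_one_of_floor_eq_floor hij.2
    rw [← sub_div, sub_sub_sub_cancel_right, abs_div, abs_of_pos hg, div_lt_one hg] at h2
    linarith
  have hle : ∀ k, (1 + (x - p k) ^ 2)⁻¹ ≤ 3 * (1 + g⁻¹ ^ 2) * u (φ k) := fun k => by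
    simp only [hu, hφ, one_mul]
    set y := (p k - x) / g with hy
    have h1 := Int.floor_le y
    have h2 := Int.lt_floor_add_one y
    have hxy : (x - p k) ^ 2 = g ^ 2 * y ^ 2 := by rw [hy]; field_simp; ring
    have h3 : (1 + (⌊y⌋ : ℝ) ^ 2) ≤ 3 * (1 + y ^ 2) := by
      nlinarith [sq_nonneg (y - 1), sq_nonneg (y + 1)]
    have h4 : 1 + y ^ 2 ≤ (1 + g⁻¹ ^ 2) * (1 + (x - p k) ^ 2) := by
      have : g⁻¹ ^ 2 * (g ^ 2 * y ^ 2) = y ^ 2 := by field_simp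
      rw [hxy]
      have h5 : 0 ≤ g⁻¹ ^ 2 := by positivity
      have h6 : 0 ≤ g ^ 2 * y ^ 2 := by positivity
      nlinarith
    rw [← div_eq_mul_inv, inv_eq_one_div, div_le_div_iff₀ (by positivity) (by positivity)]
    linarith
  calc ∑ k ∈ s, (1 + (x - p k) ^ 2)⁻¹ ≤ ∑ k ∈ s, 3 * (1 + g⁻¹ ^ 2) * u (φ k) :=
        Finset.sum_le_sum fun k _ => hle k
    _ = 3 * (1 + g⁻¹ ^ 2) * ∑ q ∈ s.map ⟨φ, hinj⟩, u q := by
        rw [← Finset.mul_sum, Finset.sum_map]; rfl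
    _ ≤ _ := by
        refine mul_le_mul_of_nonneg_left (husum.sum_le_tsum _ fun q _ => ?_) (by positivity)
        simp only [hu]
        positivity

/-- The reflected nodes `-p j`, `2 ≤ j ≤ M`, as zeros of a polynomial equal to one at `p k`. -/
lemma exists_polynomial_factor (h : IsNodeSequence p M g) :
    ∃ (n : ℕ) (c : ℝ), 0 < c ∧ ∀ k, ∃ E : ℂ → ℂ, Differentiable ℂ E ∧ E (p k) = 1 ∧
      (∀ j : ℕ+, 1 < j → j ≤ M → E (-p j) = 0) ∧ ∀ z, ‖E z‖ ≤ c * (1 + ‖z - p k‖) ^ n := by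
  have h2 := h.two_pos
  refine ⟨(Finset.Icc 2 M).card, (1 + (p 2)⁻¹) ^ (Finset.Icc 2 M).card, by positivity, fun k =>
    -- Each factor equals `(z + p j)/(p k + p j)`; the bound `p k + p j ≥ p 2` makes the estimate
    -- uniform in `k`.
    ⟨fun z => ∏ j ∈ Finset.Icc 2 M, (1 + ((p k + p j)⁻¹ : ℝ) * (z - p k)), ?_, ?_, ?_, ?_⟩⟩
  · exact Differentiable.fun_finsetProd fun j _ => by fun_prop
  · simp
  · intro j hj hjM
    refine Finset.prod_eq_zero (Finset.mem_Icc.2 ⟨PNat.add_one_le_iff.2 hj, hjM⟩) ?_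
    have : (p k + p j : ℂ) ≠ 0 := by
      have : p k + p j ≠ 0 := by linarith [h.nonneg k, h.le_of_one_lt hj]
      exact_mod_cast this
    push_cast
    field_simp
    ring
  · intro z
    rw [norm_prod, ← mul_pow]
    refine (Finset.prod_le_prod (fun _ _ => norm_nonneg _) fun j hj => ?_).trans_eq
      (Finset.prod_const _)
    have hj2 : p 2 ≤ p k + p j := by
      have := h.strictMono.monotone (Finset.mem_Icc.1 hj).1
      linarith [h.nonneg k]
    refine (norm_add_le _ _).trans ?_
    rw [norm_one, norm_mul, Complex.norm_real, Real.norm_of_nonneg (inv_nonneg.2 (h2.le.trans hj2))]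
    have h3 := mul_le_mul_of_nonneg_right (inv_anti₀ h2 hj2) (norm_nonneg (z - p k))
    have h4 : 0 < (p 2)⁻¹ := by positivity
    nlinarith [norm_nonneg (z - p k)]

/-- Only the `M - 1` classes not containing `k` can come within `c` of `p k`; this is the source of
the exponent `M - 1`. -/
lemma dist_residueNodes (h : IsNodeSequence p M g) {c q : ℝ} {k : ℕ+} (hc2 : c ≤ p 2) (hcg : c ≤ g)
    (hq1 : q ≤ 1) (hc0 : 0 ≤ c)
    (hsep : ∀ j, j ≠ k → (j : ℕ) % M ≠ (k : ℕ) % M → c * q ≤ |p j - p k|) {r : ℕ} {s : ℝ}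
    (hs : s ∈ residueNodes p M r) (hsk : s ≠ p k) :
    (if r = (k : ℕ) % M then c else c * q) ≤ |s - p k| := by
  have hcq : c * q ≤ c := mul_le_of_le_one_right hc0 hq1
  obtain ⟨j, hj, rfl | ⟨rfl, hjM⟩⟩ := hs
  · have hne : j ≠ k := by rintro rfl; exact hsk rfl
    split_ifs with hr
    · exact hcg.trans (h.gap_le_abs hne (hj.trans hr))
    · exact hsep j hne (by rwa [hj])
  · have h1 : c ≤ |-p j - p k| := by
      rw [← neg_add', abs_neg]
      have := h.le_of_one_lt ((one_le (a := M)).trans_lt hjM)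
      exact (by linarith [h.nonneg k] : c ≤ p j + p k).trans (le_abs_self _)
    split_ifs
    · exact h1
    · exact hcq.trans h1

lemma prod_residue_weights {c q : ℝ} (k M : ℕ) (hM : 0 < M) :
    ∏ r ∈ Finset.range M, (if r = k % M then c else c * q)⁻¹ = c⁻¹ ^ M * (q⁻¹) ^ (M - 1) := by
  have hmem : k % M ∈ Finset.range M := Finset.mem_range.2 (Nat.mod_lt _ hM)
  have : ∀ r ∈ Finset.range M, (if r = k % M then c else c * q)⁻¹ =
      c⁻¹ * (if r = k % M then 1 else q⁻¹) := fun r _ => by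
    split_ifs
    · rw [mul_one]
    · rw [mul_inv]
  rw [Finset.prod_congr rfl this, Finset.prod_mul_distrib, Finset.prod_const, Finset.card_range,
    ← Finset.mul_prod_erase _ _ hmem, if_pos rfl, one_mul,
    Finset.prod_congr rfl fun r hr => if_neg (Finset.ne_of_mem_erase hr), Finset.prod_const,
    Finset.card_erase_of_mem hmem, Finset.card_range]

lemma exists_residue_product (h : IsNodeSequence p M g) {c₀ : ℝ} (hc₀ : 0 < c₀) {q : ℕ+ → ℝ}
    (hq0 : ∀ k, 0 < q k) (hq1 : ∀ k, q k ≤ 1)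
    (hsep : ∀ k j : ℕ+, j ≠ k → (j : ℕ) % M ≠ (k : ℕ) % M → c₀ * q k ≤ |p j - p k|) :
    ∃ K : ℝ, 0 < K ∧ ∀ k, ∃ F : ℂ → ℂ, Differentiable ℂ F ∧ F (p k) = 1 ∧
      (∀ j, j ≠ k → F (p j) = 0) ∧ (∀ j, M < j → F (-p j) = 0) ∧
      ∀ z, ‖F z‖ ≤ K * (q k)⁻¹ ^ ((M : ℕ) - 1) * (1 + ‖z - p k‖) ^ (4 * (M : ℕ)) *
        Real.exp (M * (Real.pi / g) * |z.im|) := by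
  obtain ⟨c, hc, hH⟩ := exists_entire_vanishing_on_separated_of_gap h.pos
  -- The three terms control, in order, nodes of other classes, reflected nodes, and nodes of the
  -- same class.
  set c₁ := min c₀ (min (p 2) g) with hc₁
  have hc₁0 : 0 < c₁ := lt_min hc₀ (lt_min h.two_pos h.pos)
  have hc₁c : c₁ ≤ c₀ := min_le_left _ _
  have hc₁2 : c₁ ≤ p 2 := (min_le_right _ _).trans (min_le_left _ _)
  have hc₁g : c₁ ≤ g := (min_le_right _ _).trans (min_le_right _ _)
  refine ⟨c ^ (M : ℕ) * c₁⁻¹ ^ (M : ℕ), by positivity, fun k => ?_⟩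
  have hfac : ∀ r : ℕ, ∃ H : ℂ → ℂ, Differentiable ℂ H ∧ H (p k) = 1 ∧
      (∀ s ∈ residueNodes p M r, s ≠ p k → H (s : ℂ) = 0) ∧
      ∀ z, ‖H z‖ ≤ c * (if r = (k : ℕ) % M then c₁ else c₁ * q k)⁻¹ * (1 + ‖z - p k‖) ^ 4 *
        Real.exp (Real.pi / g * |z.im|) := fun r => by
    have hcq : c₁ * q k ≤ c₁ := mul_le_of_le_one_right hc₁0.le (hq1 k)
    obtain ⟨H, hd, h1, hz, hb⟩ := hH (residueNodes p M r \ {p k}) (p k)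
      (if r = (k : ℕ) % M then c₁ else c₁ * q k)
      (fun s hs t ht hst => h.residueNodes_separated hs.1 ht.1 hst)
      (by have := hq0 k; split_ifs <;> positivity)
      (by split_ifs <;> linarith)
      (fun s hs => h.dist_residueNodes hc₁2 hc₁g (hq1 k) hc₁0.le
        (fun j hj hjm => (mul_le_mul_of_nonneg_right hc₁c (hq0 k).le).trans (hsep k j hj hjm))
        hs.1 hs.2)
    exact ⟨H, hd, h1, fun s hs hsk => hz s ⟨hs, hsk⟩, hb⟩
  choose H hd h1 hz hb using hfac
  have hvan : ∀ (j : ℕ+) (s : ℝ), s ∈ residueNodes p M ((j : ℕ) % M) → s ≠ p k →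
      ∏ r ∈ Finset.range M, H r (s : ℂ) = 0 := fun j s hs hsk =>
    Finset.prod_eq_zero (Finset.mem_range.2 (Nat.mod_lt _ M.pos)) (hz _ s hs hsk)
  refine ⟨fun z => ∏ r ∈ Finset.range M, H r z,
    Differentiable.fun_finsetProd fun r _ => hd r, by simp [h1], fun j hj => ?_, fun j hj => ?_,
    fun z => ?_⟩
  · exact hvan j (p j) ⟨j, rfl, Or.inl rfl⟩ (h.strictMono.injective.ne hj)
  · have := hvan j (-p j) ⟨j, rfl, Or.inr ⟨rfl, hj⟩⟩
      (by linarith [h.nonneg k, h.gap_le_of_lt hj, h.pos])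
    simpa using this
  · rw [norm_prod]
    refine (Finset.prod_le_prod (fun _ _ => norm_nonneg _) fun r _ => hb r z).trans_eq ?_
    rw [Finset.prod_mul_distrib, Finset.prod_mul_distrib, Finset.prod_mul_distrib,
      prod_residue_weights _ _ M.pos, Finset.prod_const, Finset.prod_const, Finset.prod_const,
      Finset.card_range, ← pow_mul, ← Real.exp_nat_mul]
    ring_nf

/-- Paley–Wiener functions of type just above the critical one, which interpolate a unit datum
at the node `p k` and vanish at all other nodes and at the reflections of the positive nodes. -/
theorem exists_interpolating_family (h : IsNodeSequence p M g) {c₀ : ℝ} (hc₀ : 0 < c₀)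
    {q : ℕ+ → ℝ} (hq0 : ∀ k, 0 < q k) (hq1 : ∀ k, q k ≤ 1)
    (hsep : ∀ k j : ℕ+, j ≠ k → (j : ℕ) % M ≠ (k : ℕ) % M → c₀ * q k ≤ |p j - p k|)
    {τ : ℝ} (hτ : M / (2 * g) < τ) :
    ∃ K : ℝ, 0 ≤ K ∧ ∀ k, ∃ G : ℂ → ℂ, Differentiable ℂ G ∧ G (p k) = 1 ∧
      (∀ j, j ≠ k → G (p j) = 0) ∧ (∀ j, 1 < j → G (-p j) = 0) ∧
      ∀ z, ‖G z‖ ≤ K * (q k)⁻¹ ^ ((M : ℕ) - 1) *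
        (((1 + ‖z - p k‖) ^ 2)⁻¹ * Real.exp (2 * Real.pi * τ * |z.im|)) := by
  obtain ⟨n, c, hc, hE⟩ := h.exists_polynomial_factor
  obtain ⟨K₁, hK₁, hF⟩ := h.exists_residue_product hc₀ hq0 hq1 hsep
  have hε : 0 < 2 * Real.pi * τ - M * (Real.pi / g) := by
    have : M * (Real.pi / g) = 2 * Real.pi * (M / (2 * g)) := by
      have := h.pos
      field_simp
    rw [this, ← mul_sub]
    exact mul_pos Real.two_pi_pos (sub_pos.2 hτ)
  -- The order `4M` absorbs the class products, `n` the polynomial factor, and 2 remains as decay.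
  obtain ⟨ψ, hψd, hψ0, K₂, hK₂, hψ⟩ := exists_entire_decay (4 * M + n + 2) hε
  refine ⟨K₁ * c * K₂, by positivity, fun k => ?_⟩
  obtain ⟨E, hEd, hE1, hEz, hEb⟩ := hE k
  obtain ⟨F, hFd, hF1, hFz, hFz', hFb⟩ := hF k
  refine ⟨fun z => F z * E z * ψ (z - p k), ?_, ?_, ?_, ?_, ?_⟩
  · exact (hFd.mul hEd).mul (hψd.comp (by fun_prop))
  · simp [hF1, hE1, hψ0]
  · intro j hj
    simp [hFz j hj]
  · intro j hj
    rcases le_or_gt j M with hjM | hjM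
    · simp [hEz j hj hjM]
    · simp [hFz' j hjM]
  · intro z
    have hq := hq0 k
    have him : (z - p k).im = z.im := by simp
    have hψz := hψ (z - p k)
    rw [him] at hψz
    set X := 1 + ‖z - p k‖
    have hX : 0 < X := by positivity
    rw [norm_mul, norm_mul]
    calc ‖F z‖ * ‖E z‖ * ‖ψ (z - p k)‖
        ≤ (K₁ * (q k)⁻¹ ^ ((M : ℕ) - 1) * X ^ (4 * (M : ℕ)) *
            Real.exp (M * (Real.pi / g) * |z.im|)) * (c * X ^ n) *
          (K₂ * (X ^ (4 * (M : ℕ) + n + 2))⁻¹ *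
            Real.exp ((2 * Real.pi * τ - M * (Real.pi / g)) * |z.im|)) := by
          gcongr
          · exact hFb z
          · exact hEb z
      _ = K₁ * c * K₂ * (q k)⁻¹ ^ ((M : ℕ) - 1) *
          ((X ^ (4 * (M : ℕ)) * X ^ n * (X ^ (4 * (M : ℕ) + n + 2))⁻¹) *
          (Real.exp (M * (Real.pi / g) * |z.im|) *
            Real.exp ((2 * Real.pi * τ - M * (Real.pi / g)) * |z.im|))) := by ring
      _ = _ := by
          rw [← Real.exp_add, ← add_mul, add_sub_cancel]
          congr 3
          rw [pow_add X _ 2, pow_add, mul_inv (X ^ _ * X ^ n), mul_inv_cancel_left₀ (by positivity)]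

/-- Solution of the complex moment problem at the nodes and their reflections, on a symmetric
interval. -/
theorem exists_moment_solution (h : IsNodeSequence p M g) {c₀ : ℝ} (hc₀ : 0 < c₀)
    {q : ℕ+ → ℝ} (hq0 : ∀ k, 0 < q k) (hq1 : ∀ k, q k ≤ 1)
    (hsep : ∀ k j : ℕ+, j ≠ k → (j : ℕ) % M ≠ (k : ℕ) % M → c₀ * q k ≤ |p j - p k|)
    {τ : ℝ} (hτ : M / (2 * g) < τ) {c : ℕ+ → ℂ}
    (hc : Summable fun k => (‖c k‖ * (q k)⁻¹ ^ ((M : ℕ) - 1)) ^ 2) :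
    ∃ V : ℝ → ℂ, MemLp V 2 ∧ (∀ ξ, ξ ∉ Set.Icc (-τ) τ → V ξ = 0) ∧
      (∀ k, ∫ ξ : ℝ, Complex.exp (2 * Real.pi * p k * ξ * Complex.I) * V ξ = c k) ∧
      ∀ k, 1 < k → ∫ ξ : ℝ, Complex.exp (-(2 * Real.pi * p k * ξ * Complex.I)) * V ξ = 0 := by
  have hτ0 : 0 ≤ τ := le_trans (by have := h.pos; positivity) hτ.le
  obtain ⟨K, hK, hG⟩ := h.exists_interpolating_family hc₀ hq0 hq1 hsep hτ
  choose G hGd hG1 hGz hGz' hGb using hG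
  obtain ⟨B, hB⟩ := h.exists_sum_inv_one_add_sq_le
  set κ : ℕ+ → ℝ := fun k => ‖c k‖ * (K * (q k)⁻¹ ^ ((M : ℕ) - 1)) with hκ
  have hκ0 : ∀ k, 0 ≤ κ k := fun k => by have := hq0 k; positivity
  have hle : ∀ k z, ‖c k * G k z‖ ≤
      κ k * (((1 + ‖z - p k‖) ^ 2)⁻¹ * Real.exp (2 * Real.pi * τ * |z.im|)) := fun k z => by
    rw [norm_mul, hκ, mul_assoc]
    exact mul_le_mul_of_nonneg_left (hGb k z) (norm_nonneg _)
  obtain ⟨V, hV, hsupp, hsum⟩ := exists_memLp_hasSum_integral_exp hτ0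
    (G := fun k z => c k * G k z) (p := p) (κ := κ) (B := B)
    -- Recentring the decay from `p k` to 0 costs a factor depending on `k`. This is harmless, as
    -- `IsPaleyWiener` is used only qualitatively.
    (fun k => ⟨(hGd k).const_mul _, κ k * (1 + ‖(p k : ℂ)‖) ^ 2, fun z => (hle k z).trans (by
      rw [mul_assoc (κ k), ← mul_assoc (_ ^ 2)]
      refine mul_le_mul_of_nonneg_left (mul_le_mul_of_nonneg_right ?_ (by positivity)) (hκ0 k)
      rw [← div_eq_mul_inv, inv_eq_one_div, div_le_div_iff₀ (by positivity) (by positivity),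
        one_mul, ← mul_pow]
      have h1 : ‖z‖ ≤ ‖z - p k‖ + ‖(p k : ℂ)‖ := by
        simpa using norm_add_le (z - p k) (p k : ℂ)
      have h2 : 1 + ‖z‖ ≤ (1 + ‖(p k : ℂ)‖) * (1 + ‖z - p k‖) := by
        nlinarith [mul_nonneg (norm_nonneg (p k : ℂ)) (norm_nonneg (z - p k))]
      refine le_trans ?_ (pow_le_pow_left₀ (by positivity) h2 2)
      nlinarith [norm_nonneg z])⟩)
    (fun k x => (hle k x).trans (by
      refine mul_le_mul_of_nonneg_left ?_ (hκ0 k)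
      rw [Complex.ofReal_im, abs_zero, mul_zero, Real.exp_zero, mul_one, ← Complex.ofReal_sub,
        Complex.norm_real, Real.norm_eq_abs]
      refine inv_anti₀ (by positivity) ?_
      rw [← sq_abs (x - p k)]
      nlinarith [abs_nonneg (x - p k)]))
    hB (by
      refine (hc.mul_left (K ^ 2)).congr fun k => ?_
      rw [hκ]
      ring)
  refine ⟨V, hV, hsupp, fun k => ?_, fun k hk => ?_⟩
  · refine (hsum (p k)).unique ?_
    have h1 := hasSum_single (f := fun j => c j * G j (p k)) k
      fun j hj => by rw [hGz j k hj.symm, mul_zero]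
    rwa [hG1, mul_one] at h1
  · have h1 := (hsum (-p k)).unique (hasSum_zero.congr_fun ?_)
    · simpa using h1
    · intro j
      simp [hGz' j k hk]

end IsNodeSequence

/-! ### Real solutions on `(0, T)` and the conclusion. -/

/-- Passing from the symmetric interval to `(0, T)` and from complex to real solutions. -/
lemma integral_Ioo_two_mul_re {V : ℝ → ℂ} {T : ℝ} (hV : MemLp V 2)
    (hsupp : ∀ ξ, ξ ∉ Set.Icc (-(T / 2)) (T / 2) → V ξ = 0) (w : ℝ) :
    ∫ t in Set.Ioo 0 T, ((2 * (V (t - T / 2)).re : ℝ) : ℂ) * Complex.exp (Complex.I * w * t) =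
      Complex.exp (Complex.I * w * (T / 2)) *
        ((∫ ξ : ℝ, Complex.exp (w * ξ * Complex.I) * V ξ) +
          starRingEnd ℂ (∫ ξ : ℝ, Complex.exp (-(w * ξ * Complex.I)) * V ξ)) := by
  have hVi : Integrable V := by
    have h1 : IntegrableOn V (Set.Icc (-(T / 2)) (T / 2)) :=
      (hV.restrict _).integrable (by norm_num)
    exact (integrableOn_iff_integrable_of_support_subset fun ξ hξ => by
      by_contra hn
      exact hξ (hsupp ξ hn)).1 h1
  have hint : ∀ a : ℝ, Integrable fun ξ : ℝ => Complex.exp (a * ξ * Complex.I) * V ξ := fun a => by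
    refine hVi.bdd_mul (c := 1) (by fun_prop) (ae_of_all _ fun ξ => ?_)
    rw [Complex.norm_exp]
    simp
  have h0 : ∀ t, t ∉ Set.Icc 0 T →
      ((2 * (V (t - T / 2)).re : ℝ) : ℂ) * Complex.exp (Complex.I * w * t) = 0 := fun t ht => by
    rw [hsupp (t - T / 2) fun h => ht ⟨by linarith [h.1], by linarith [h.2]⟩]
    simp
  rw [← integral_Icc_eq_integral_Ioo, setIntegral_eq_integral_of_forall_compl_eq_zero h0,
    ← integral_add_right_eq_self _ (T / 2), ← integral_conj, ← integral_add (hint w) ?_,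
    ← integral_const_mul]
  · refine integral_congr_ae (ae_of_all _ fun ξ => ?_)
    have h2 : ((2 * (V ξ).re : ℝ) : ℂ) = V ξ + starRingEnd ℂ (V ξ) := (Complex.add_conj _).symm
    simp only [add_sub_cancel_right, h2, map_mul, ← Complex.exp_conj]
    have h3 : Complex.exp (Complex.I * w * ((ξ + T / 2 : ℝ) : ℂ)) =
        Complex.exp (Complex.I * w * (T / 2)) * Complex.exp (w * ξ * Complex.I) := by
      rw [← Complex.exp_add]
      congr 1
      push_cast
      ring
    rw [h3]
    simp
    ring
  · have := hint (-w)
    have h4 := (Complex.conjLIE.toContinuousLinearEquiv : ℂ ≃L[ℝ] ℂ).integrable_comp_iff.2 this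
    simpa using h4

theorem propositionB5 (ω : ℕ+ → ℝ) (hω_nonneg : ∀ k, 0 ≤ ω k) (hω_mono : Monotone ω)
    (hω_one : ω 1 = 0)
    (d δ C : ℝ) (M : ℕ+) (hd : 0 ≤ d) (hδ : 0 < δ) (hC : 0 < C)
    (hgapM : δ * ((M : ℕ) : ℝ) ≤ ⨅ k : ℕ+, |ω (k + M) - ω k|)
    -- for `M = 1` the exponent `d / (M - 1)` is meaningless and no second condition is imposed
    (hgap : M ≠ 1 → ∀ k : ℕ+,
      C * ((k : ℕ) : ℝ) ^ (-(d / (((M : ℕ) : ℝ) - 1))) ≤ |ω (k + 1) - ω k|)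
    (T : ℝ) (hT : 2 * Real.pi / δ < T)
    (x : ℕ+ → ℂ) (hx : x ∈ hSpace d) (hx_one : (x 1).im = 0) :
    ∃ u : ℝ → ℝ,
      MeasureTheory.MemLp u 2 (MeasureTheory.volume.restrict (Set.Ioo 0 T)) ∧
      ∀ k : ℕ+, x k =
        ∫ τ in Set.Ioo 0 T, ((u τ : ℝ) : ℂ) * Complex.exp (Complex.I * (ω k : ℂ) * (τ : ℂ)) := by
  have hpi := Real.pi_pos
  have hM0 : (0 : ℝ) < (M : ℕ) := by exact_mod_cast M.pos
  have hk1 : ∀ k : ℕ+, (1 : ℝ) ≤ (k : ℕ) := fun k => by exact_mod_cast k.pos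
  have hstep : ∀ k m : ℕ+, |ω (k + m) - ω k| = ω (k + m) - ω k := fun k m =>
    abs_of_nonneg (sub_nonneg.2 (hω_mono (PNat.lt_add_right k m).le))
  have hgapM' : ∀ k, δ * (M : ℕ) ≤ ω (k + M) - ω k := fun k => by
    rw [← hstep]
    exact hgapM.trans (ciInf_le ⟨0, by rintro _ ⟨k, rfl⟩; exact abs_nonneg _⟩ k)
  -- For `M = 1` division by zero gives `e = 0`, so the weights `k ^ (-e)` are all 1.
  set e : ℝ := d / (((M : ℕ) : ℝ) - 1) with he
  have he0 : 0 ≤ e := div_nonneg hd (sub_nonneg.2 (hk1 M))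
  have hgap' : M ≠ 1 → ∀ k : ℕ+, C * ((k : ℕ) : ℝ) ^ (-e) ≤ ω (k + 1) - ω k := fun hM k => by
    rw [← hstep]
    exact hgap hM k
  have hlt : ∀ k, ω k < ω (k + 1) := fun k => by
    rw [← sub_pos]
    by_cases hM : M = 1
    · have := hgapM' k
      rw [hM] at this
      exact lt_of_lt_of_le (by simpa using hδ) this
    · refine lt_of_lt_of_le ?_ (hgap' hM k)
      have := hk1 k
      positivity
  have hnode : IsNodeSequence (fun k => ω k / (2 * Real.pi)) M (δ * (M : ℕ) / (2 * Real.pi)) := by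
    refine ⟨fun i j hij => ?_, by simp [hω_one], by positivity, fun k => ?_⟩
    · exact div_lt_div_of_pos_right
        ((hlt i).trans_le (hω_mono (PNat.add_one_le_iff.2 hij))) Real.two_pi_pos
    · rw [← add_div]
      exact div_le_div_of_nonneg_right (by linarith [hgapM' k]) Real.two_pi_pos.le
  have hsep : ∀ k j : ℕ+, j ≠ k → M ≠ 1 → C * ((k : ℕ) : ℝ) ^ (-e) ≤ |ω j - ω k| := by
    intro k j hjk hM
    rcases lt_or_gt_of_ne hjk with h | h
    -- For `j < k` the relevant gap starts at `k - 1`, and `(k - 1) ^ (-e) ≥ k ^ (-e)`.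
    · obtain ⟨i, rfl⟩ := PNat.exists_eq_succ_of_ne_one (n := k)
        (by rintro rfl; exact absurd h (not_lt.2 one_le))
      rw [abs_sub_comm]
      refine le_trans ?_ ((sub_le_sub_left (hω_mono (PNat.lt_add_one_iff.1 h)) _).trans
        (le_abs_self _))
      refine le_trans (mul_le_mul_of_nonneg_left ?_ hC.le) (hgap' hM i)
      refine Real.rpow_le_rpow_of_nonpos (by linarith [hk1 i]) ?_ (neg_nonpos.2 he0)
      push_cast
      linarith
    · exact (hgap' hM k).trans ((sub_le_sub_right (hω_mono (PNat.add_one_le_iff.2 h)) _).trans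
        (le_abs_self _))
  -- The exponential undoes the translation by `T/2`; the factor `1/2` at `k = 1` is there because
  -- frequency 0 is counted twice in `V + conj V`.
  set c : ℕ+ → ℂ := fun k =>
    (if k = 1 then 1 / 2 else 1) * x k * Complex.exp (-(Complex.I * ω k * (T / 2))) with hc
  have hcn : ∀ k, ‖c k‖ ≤ ‖x k‖ := fun k => by
    have h1 : ‖Complex.exp (-(Complex.I * ω k * (T / 2)))‖ = 1 := by
      rw [Complex.norm_exp]
      have : (-(Complex.I * ω k * (T / 2))).re = 0 := by
        rw [show (T / 2 : ℂ) = ((T / 2 : ℝ) : ℂ) by push_cast; rfl]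
        simp
      rw [this, Real.exp_zero]
    rw [hc, norm_mul, norm_mul, h1, mul_one]
    refine mul_le_of_le_one_left (norm_nonneg _) ?_
    split_ifs <;> norm_num
  have hpow : ∀ k : ℕ+, ((((k : ℕ) : ℝ) ^ (-e))⁻¹) ^ ((M : ℕ) - 1) ≤ ((k : ℕ) : ℝ) ^ d := fun k => by
    rw [← Real.rpow_neg (by linarith [hk1 k]), neg_neg, ← Real.rpow_natCast,
      ← Real.rpow_mul (by linarith [hk1 k])]
    refine Real.rpow_le_rpow_of_exponent_le (hk1 k) ?_
    rw [Nat.cast_sub M.pos, Nat.cast_one, he]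
    rcases eq_or_ne (((M : ℕ) : ℝ) - 1) 0 with h | h
    · rw [h, mul_zero]
      exact hd
    · rw [div_mul_cancel₀ d h]
  obtain ⟨V, hV, hsupp, hmom, hmom'⟩ := hnode.exists_moment_solution
    (c₀ := C / (2 * Real.pi)) (by positivity) (q := fun k => ((k : ℕ) : ℝ) ^ (-e))
    (fun k => Real.rpow_pos_of_pos (by linarith [hk1 k]) _)
    (fun k => Real.rpow_le_one_of_one_le_of_nonpos (hk1 k) (neg_nonpos.2 he0))
    (fun k j hjk hmod => by
      rw [← sub_div, abs_div, abs_of_pos Real.two_pi_pos, div_mul_eq_mul_div]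
      refine div_le_div_of_nonneg_right (hsep k j hjk ?_) Real.two_pi_pos.le
      rintro rfl
      exact hmod (by simp [Nat.mod_one]))
    (τ := T / 2)
    (by
      -- Here `M/(2g) = π/δ`, so the critical half-length is exceeded exactly when `T > 2π/δ`.
      refine lt_of_eq_of_lt ?_ (div_lt_div_of_pos_right hT two_pos)
      field_simp)
    (c := c)
    (by
      refine Summable.of_nonneg_of_le (fun k => sq_nonneg _) (fun k => ?_) hx
      have := hk1 k
      have hnorm : ‖((((k : ℕ) : ℝ) ^ d : ℝ) : ℂ) * x k‖ = ‖x k‖ * ((k : ℕ) : ℝ) ^ d := by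
        rw [norm_mul, Complex.norm_real, Real.norm_of_nonneg (by positivity), mul_comm]
      rw [hnorm]
      gcongr
      · exact hcn k
      · exact hpow k)
  have hfreq : ∀ k, 2 * (Real.pi : ℂ) * ((ω k / (2 * Real.pi) : ℝ) : ℂ) = ω k := fun k => by
    have : (Real.pi : ℂ) ≠ 0 := by exact_mod_cast hpi.ne'
    push_cast
    field_simp
  simp only [hfreq] at hmom hmom'
  refine ⟨fun t => 2 * (V (t - T / 2)).re, ?_, fun k => ?_⟩
  · have h1 : MemLp (fun t => V (t - T / 2)) 2 :=
      hV.comp_measurePreserving (measurePreserving_sub_right volume (T / 2))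
    exact (h1.re.const_mul 2).restrict _
  · rw [integral_Ioo_two_mul_re hV hsupp, hmom]
    by_cases hk : k = 1
    · subst hk
      have hm1 := hmom 1
      simp only [hω_one, Complex.ofReal_zero, zero_mul, neg_zero] at hm1 ⊢
      rw [hm1]
      have hreal : starRingEnd ℂ (x 1) = x 1 := Complex.conj_eq_iff_im.2 hx_one
      simp [hc, hω_one, hreal, Complex.conj_ofNat]
      ring
    · rw [hmom' k (lt_of_le_of_ne one_le (Ne.symm hk)), map_zero, add_zero]
      simp only [hc, if_neg hk, one_mul]
      rw [mul_comm, mul_assoc, ← Complex.exp_add, neg_add_cancel, Complex.exp_zero, mul_one]
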